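/- Write $I_{\vec a}$ for the unit mass at $\vec a\in\mathbb{R}^d$ and $I=I_{\vec 0}$. For finite signed Borel measures $M,V$ on $\mathbb{R}^d$ let $M*V$ be their convolution, $M^{*j}$ the convolution powers ($M^{*0}=I$), $\exp\{M\}=\sum_{j\ge 0}M^{*j}/j!$, and $\|M\|_{TV}=|M|(\mathbb{R}^d)$ the total variation norm. For a probability distribution $F$ on $\mathbb{R}^d$ and $a\in\mathbb{R}$ put \[ D^{*a}=\exp\Bigl\{a(F-I)-\frac{a}{2}(F-I)^{*2}\Bigr\},\qquad D=D^{*1}, \] and for $y\ge 0$ \[ \delta(y)=\sum_{\vec x\in\mathbb{Z}^d\setminus\{\vec 0\}}\min\bigl(1,\,y\,e\,F\{\vec x\}\bigr). \] For integers $0\le k<n$ let \[ M_k=F^{*n}-\sum_{m=0}^{k}\binom{n}{m}D^{*(n-m)}*(F-D)^{*m}. \] **Theorem.** For every integer $k\ge 0$ there is a constant $C(k)>0$, depending only on $k$, such that the following holds for every dimension $d$, every symmetric probability distribution $F$ on $\mathbb{R}^d$ (that is, $F\{A\}=F\{-A\}$ for all Borel sets $A$) with $\operatorname{supp}F\subset\mathbb{Z}^d$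 and $q:=F\{\vec 0\}\in(0,1)$, and every integer $n>k$: \[ \|M_k\|_{TV}\le\frac{C(k)\,\delta(nq)^{3(k+1)}}{q^{6k+11/2}\,n^{2(k+1)}}+\frac{C(k)\,(1-q)^{6(k+1)}}{n^{2(k+1)}\,q^{6k+13/2}}. \] -/

import Mathlib

open MeasureTheory Set

noncomputable section

namespace SignedConv

/-- The total variation norm `‖M‖ = |M|(G)` of a finite signed measure, where `|M|` is the sum of
the positive and negative parts in the Hahn–Jordan decomposition of `M`. -/
def tvNorm {G : Type*} [MeasurableSpace G] (M : SignedMeasure G) : ℝ :=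
  M.totalVariation.real univ

instance instIsFiniteMeasureVariation {G : Type*} [MeasurableSpace G] (M : SignedMeasure G) :
    IsFiniteMeasure M.variation := by
  rw [← SignedMeasure.totalVariation_eq_variation]
  unfold SignedMeasure.totalVariation
  infer_instance

theorem hasSum_series_iUnion {G : Type*} [MeasurableSpace G]
    {μ : ℕ → SignedMeasure G} {c : ℕ → ℝ} (hc : ∀ j, 0 ≤ c j)
    (hμ : Summable fun j => c j * (μ j).variation.real univ) {f : ℕ → Set G}
    (hf : ∀ i, MeasurableSet (f i)) (hd : Pairwise (Function.onFun Disjoint f)) :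
    HasSum (fun i => ∑' j, c j * μ j (f i)) (∑' j, c j * μ j (⋃ i, f i)) := by
  have hv : ∀ j, HasSum (fun i => (μ j).variation.real (f i))
      ((μ j).variation.real (⋃ i, f i)) := by
    intro j
    have h := (μ j).variation.toSignedMeasure.m_iUnion hf hd
    simpa only [Measure.toSignedMeasure_apply_measurable (hf _),
      Measure.toSignedMeasure_apply_measurable (MeasurableSet.iUnion hf)] using h
  have hb : Summable fun p : ℕ × ℕ => c p.1 * (μ p.1).variation.real (f p.2) := by
    have h0 : ∀ p : ℕ × ℕ, 0 ≤ c p.1 * (μ p.1).variation.real (f p.2) := fun p =>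
      mul_nonneg (hc _) measureReal_nonneg
    have h1 : ∀ j, Summable fun i => c j * (μ j).variation.real (f i) := fun j =>
      (hv j).summable.mul_left (c j)
    refine (summable_prod_of_nonneg h0).2 ⟨h1, ?_⟩
    refine Summable.of_nonneg_of_le (fun j => tsum_nonneg fun i => h0 (j, i)) (fun j => ?_) hμ
    have ht : ∑' i, c j * (μ j).variation.real (f i) =
        c j * (μ j).variation.real (⋃ i, f i) := ((hv j).mul_left (c j)).tsum_eq
    refine ht.le.trans ?_
    exact mul_le_mul_of_nonneg_left (measureReal_mono (subset_univ _)) (hc j)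
  have hsum : Summable fun p : ℕ × ℕ => c p.1 * μ p.1 (f p.2) := by
    refine Summable.of_norm_bounded hb fun p => ?_
    rw [norm_mul, Real.norm_of_nonneg (hc _)]
    exact mul_le_mul_of_nonneg_left VectorMeasure.norm_measure_le_variation (hc _)
  have hrow : ∀ j, HasSum (fun i => c j * μ j (f i)) (c j * μ j (⋃ i, f i)) := fun j =>
    ((μ j).m_iUnion hf hd).mul_left (c j)
  have h2 : HasSum (fun j => c j * μ j (⋃ i, f i)) (∑' p : ℕ × ℕ, c p.1 * μ p.1 (f p.2)) :=
    HasSum.prod_fiberwise hsum.hasSum hrow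
  have hs : HasSum (fun p : ℕ × ℕ => c p.2 * μ p.2 (f p.1))
      (∑' p : ℕ × ℕ, c p.1 * μ p.1 (f p.2)) :=
    (Equiv.prodComm ℕ ℕ).hasSum_iff.mpr hsum.hasSum
  have hcol : ∀ i, HasSum (fun j => c j * μ j (f i)) (∑' j, c j * μ j (f i)) := fun i =>
    (hs.summable.prod_factor i).hasSum
  rw [h2.tsum_eq]
  exact HasSum.prod_fiberwise hs hcol

variable {G : Type*} [AddCommGroup G] [MeasurableSpace G]

/-- The convolution `M * V` of two finite signed measures: the image under addition of the
product signed measure `M ⊗ V`. -/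
def convolve (M V : SignedMeasure G) : SignedMeasure G :=
  (VectorMeasure.prod M V (ContinuousLinearMap.mul ℝ ℝ)).map fun p : G × G => p.1 + p.2

/-- The unit mass at the point `a`, as a signed measure. -/
def unitMass (a : G) : SignedMeasure G := VectorMeasure.dirac a 1

/-- Convolution powers `M^{*j}`, with `M^{*0}` the unit mass at the origin. -/
def convPow (M : SignedMeasure G) : ℕ → SignedMeasure G
  | 0 => unitMass 0
  | j + 1 => convolve (convPow M j) M

theorem variation_convolve_univ_le (M V : SignedMeasure G) :
    (convolve M V).variation univ ≤ M.variation univ * V.variation univ := by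
  have h1 : (convolve M V).variation univ ≤
      ((VectorMeasure.prod M V (ContinuousLinearMap.mul ℝ ℝ)).variation.map
        fun p : G × G => p.1 + p.2) univ :=
    VectorMeasure.variation_map_le univ
  have h2 : ((VectorMeasure.prod M V (ContinuousLinearMap.mul ℝ ℝ)).variation.map
      fun p : G × G => p.1 + p.2) univ ≤
      (VectorMeasure.prod M V (ContinuousLinearMap.mul ℝ ℝ)).variation univ := by
    by_cases hm : AEMeasurable (fun p : G × G => p.1 + p.2)
        (VectorMeasure.prod M V (ContinuousLinearMap.mul ℝ ℝ)).variation
    · rw [Measure.map_apply_of_aemeasurable hm MeasurableSet.univ, preimage_univ]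
    · rw [Measure.map_of_not_aemeasurable hm]
      simp
  have h3 : (VectorMeasure.prod M V (ContinuousLinearMap.mul ℝ ℝ)).variation univ ≤
      (‖ContinuousLinearMap.mul ℝ ℝ‖ₑ • M.variation.prod V.variation) univ :=
    VectorMeasure.variation_prod_le univ
  have h4 : ‖ContinuousLinearMap.mul ℝ ℝ‖ₑ = 1 := by
    rw [← ofReal_norm, ContinuousLinearMap.opNorm_mul, ENNReal.ofReal_one]
  rw [h4, one_smul, ← univ_prod_univ, Measure.prod_prod] at h3
  rw [univ_prod_univ] at h3
  exact h1.trans (h2.trans h3)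

theorem variation_convPow_univ_le (M : SignedMeasure G) (j : ℕ) :
    (convPow M j).variation.real univ ≤ M.variation.real univ ^ j := by
  suffices h : (convPow M j).variation univ ≤ M.variation univ ^ j by
    rw [measureReal_def, measureReal_def, ← ENNReal.toReal_pow]
    exact ENNReal.toReal_mono (ENNReal.pow_ne_top (measure_ne_top _ _)) h
  induction j with
  | zero => simp [convPow, unitMass]
  | succ j ih =>
    rw [pow_succ]
    exact (variation_convolve_univ_le _ _).trans (mul_le_mul_left ih _)

theorem summable_exp_variation (M : SignedMeasure G) :
    Summable fun j : ℕ => (j.factorial : ℝ)⁻¹ * (convPow M j).variation.real univ := by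
  refine Summable.of_nonneg_of_le (fun j => by positivity) (fun j => ?_)
    (Real.summable_pow_div_factorial (M.variation.real univ))
  rw [div_eq_inv_mul]
  exact mul_le_mul_of_nonneg_left (variation_convPow_univ_le M j) (by positivity)

/-- The exponential measure `exp{M} = ∑_{j ≥ 0} M^{*j} / j!`; the series converges absolutely on
every measurable set. -/
def convExp (M : SignedMeasure G) : SignedMeasure G where
  measureOf' A := ∑' j : ℕ, (j.factorial : ℝ)⁻¹ * convPow M j A
  empty' := by simp
  not_measurable' A hA := by simp [VectorMeasure.not_measurable _ hA]
  m_iUnion' _ hf hd :=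
    hasSum_series_iUnion (fun _ => by positivity) (summable_exp_variation M) hf hd

/-- For a distribution `F`, the signed measure `F - I`, with `I` the unit mass at the origin. -/
def centred (F : Measure G) [IsFiniteMeasure F] : SignedMeasure G :=
  F.toSignedMeasure - unitMass 0

/-- The signed compound Poisson measure
`D^{*a} = exp{a (F - I) - (a / 2) (F - I)^{*2}}`, for real `a`. -/
def hipp (F : Measure G) [IsFiniteMeasure F] (a : ℝ) : SignedMeasure G :=
  convExp (a • centred F - (a / 2) • convPow (centred F) 2)

/-- The remainder of the Bergström-type expansion around `D = D^{*1}`: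
`M_k = F^{*n} - ∑_{m=0}^k C(n,m) D^{*(n-m)} * (F - D)^{*m}`. -/
def bergstromRemainder (F : Measure G) [IsFiniteMeasure F] (n k : ℕ) : SignedMeasure G :=
  convPow F.toSignedMeasure n -
    ∑ m ∈ Finset.range (k + 1), (n.choose m : ℝ) •
      convolve (hipp F ((n : ℝ) - m)) (convPow (F.toSignedMeasure - hipp F 1) m)

end SignedConv

namespace IntegerLattice

/-- The point of `ℝ^d` with the integer coordinates `z`. -/
def latticePoint {d : ℕ} (z : Fin d → ℤ) : EuclideanSpace ℝ (Fin d) :=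
  WithLp.toLp 2 fun i => (z i : ℝ)

/-- `δ(y) = ∑ min (1, y e p_x)`, the sum over all non-zero `x ∈ ℤ^d`, where `p_x = F{x}`. -/
def delta {d : ℕ} (F : Measure (EuclideanSpace ℝ (Fin d))) (y : ℝ) : ℝ :=
  ∑' z : {z : Fin d → ℤ // z ≠ 0}, min 1 (y * Real.exp 1 * F.real {latticePoint z.1})

end IntegerLattice

end

/-! Since `F` lives on the lattice, every measure in the statement is a sum of lattice atoms, and
its total variation is at most the norm of its weights in the convolution algebra `ℓ¹(ℤ^d)`. There
put w = F - 1. The exponent w - w²/2 of D is the second-order Taylor polynomial of log(1 + w), so F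
- D = w³ h(w) with h entire (`one_add_sub_exp`). The identity `bergstrom_identity` writes M_k as (F
- D)^(k+1) times a combination of products F^a D^b with a + b = n - 1 - k, whose binomial weights
sum to at most n^(k+1).

From each product the common factor exp((a + b)(q/2) w) is split off. Write w = p(V - 1), where p =
1 - q and V is F conditioned on being nonzero. The leftovers of F^a and D^b are power series in V;
estimating their coefficients on the unit circle (`norm_sq_le_of_circle`) bounds them by 20 and
10/√q.

Up to a bounded correction, exp((nq/2) w) is then shared equally among the 3(k+1) factors w.
Symmetry enters here: w is a mixture of symmetrized shift increments, each a product of two first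
differences, so Poisson smoothing with parameter b gains 1/b instead of 1/√b
(`norm_symm_mul_exp_le`). Hence ‖w exp(aw)‖ is at most 1/a times the sum of truncated intensities
(`ConvAlg.norm_sub_one_mul_exp_le`), which is where δ(nq) comes from. With a of order nq the powers
of n combine to n^(k+1) n^(-3(k+1)).

The exponent of q obtained this way is 3k + 7/2, stronger than the one claimed, and the first
summand of the bound already suffices. -/

noncomputable section

/-- The space `ℓ¹(ι)` of absolutely summable real families. For an additive monoid `ι` it is a
commutative Banach algebra under convolution. -/
abbrev ConvAlg (ι : Type*) := lp (fun _ : ι => ℝ) 1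

/-! ### The Banach algebra `ℓ¹` under convolution. -/

namespace ConvAlg

variable {ι : Type*} {E : Type*} [NormedAddCommGroup E] [NormedSpace ℝ E] [CompleteSpace E]

/-- The unit mass at `i`. -/
def delta (i : ι) : ConvAlg ι := open scoped Classical in lp.single 1 i 1

theorem delta_apply [DecidableEq ι] (i j : ι) : (delta i : ConvAlg ι) j = if j = i then 1 else 0 := by
  classical
  simp only [delta, lp.single_apply, Pi.single_apply]
  congr

theorem norm_delta (i : ι) : ‖(delta i : ConvAlg ι)‖ = 1 := by
  classical
  simp [delta, lp.norm_single]

theorem hasSum_norm (f : ConvAlg ι) : HasSum (fun i => |f i|) ‖f‖ := by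
  simpa using lp.hasSum_norm (p := 1) (by simp) f

omit [CompleteSpace E] in
theorem summable_norm_smul (f : ConvAlg ι) {u : ι → E} (hu : ∀ i, ‖u i‖ ≤ 1) :
    Summable fun i => ‖f i • u i‖ := by
  refine Summable.of_nonneg_of_le (fun i => norm_nonneg _) (fun i => ?_) (hasSum_norm f).summable
  rw [norm_smul, Real.norm_eq_abs]
  exact mul_le_of_le_one_right (abs_nonneg (f i)) (hu i)

theorem summable_smul (f : ConvAlg ι) {u : ι → E} (hu : ∀ i, ‖u i‖ ≤ 1) :
    Summable fun i => f i • u i :=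
  (summable_norm_smul f hu).of_norm

omit [CompleteSpace E] in
theorem norm_tsum_smul_le (f : ConvAlg ι) {u : ι → E} (hu : ∀ i, ‖u i‖ ≤ 1) :
    ‖∑' i, f i • u i‖ ≤ ‖f‖ := by
  have h : ∀ i, ‖f i • u i‖ ≤ |f i| := fun i => by
    rw [norm_smul, Real.norm_eq_abs]
    exact mul_le_of_le_one_right (abs_nonneg (f i)) (hu i)
  have h1 : ‖∑' i, f i • u i‖ ≤ ∑' i, ‖f i • u i‖ :=
    norm_tsum_le_tsum_norm (f := fun i => f i • u i) (summable_norm_smul f hu)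
  exact h1.trans (hasSum_le h (summable_norm_smul f hu).hasSum (hasSum_norm f))

/-- The linear extension of a family of vectors in the unit ball to `ℓ¹(ι)`. -/
def extend (u : ι → E) (hu : ∀ i, ‖u i‖ ≤ 1) : ConvAlg ι →L[ℝ] E :=
  LinearMap.mkContinuous
    (IsLinearMap.mk' (fun f : ConvAlg ι => ∑' i, f i • u i)
      ⟨fun f g => by
        rw [← (summable_smul f hu).tsum_add (summable_smul g hu)]
        exact tsum_congr fun i => by rw [lp.coeFn_add, Pi.add_apply, add_smul],
      fun c f => by
        rw [← (summable_smul f hu).tsum_const_smul]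
        exact tsum_congr fun i => by rw [lp.coeFn_smul, Pi.smul_apply, smul_assoc]⟩) 1
    fun f => by simpa using norm_tsum_smul_le f hu

theorem extend_apply (u : ι → E) (hu : ∀ i, ‖u i‖ ≤ 1) (f : ConvAlg ι) :
    extend u hu f = ∑' i, f i • u i := rfl

theorem hasSum_extend (u : ι → E) (hu : ∀ i, ‖u i‖ ≤ 1) (f : ConvAlg ι) :
    HasSum (fun i => f i • u i) (extend u hu f) :=
  (summable_smul f hu).hasSum

@[simp]
theorem extend_delta (u : ι → E) (hu : ∀ i, ‖u i‖ ≤ 1) (i : ι) : extend u hu (delta i) = u i := by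
  classical
  rw [extend_apply, tsum_eq_single i]
  · simp [delta_apply]
  · intro j hj
    simp [delta_apply, hj]

theorem norm_extend_le (u : ι → E) (hu : ∀ i, ‖u i‖ ≤ 1) : ‖extend u hu‖ ≤ 1 :=
  LinearMap.mkContinuous_norm_le _ zero_le_one _

theorem norm_extend_apply_le (u : ι → E) (hu : ∀ i, ‖u i‖ ≤ 1) (f : ConvAlg ι) :
    ‖extend u hu f‖ ≤ ‖f‖ := by
  simpa using (extend u hu).le_of_opNorm_le (norm_extend_le u hu) f

theorem hasSum_delta (f : ConvAlg ι) : HasSum (fun i => f i • delta i) f := by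
  classical
  have h := lp.hasSum_single (p := 1) (by simp) f
  convert h using 2 with i
  simp [delta, ← lp.single_smul]

omit [CompleteSpace E] in
-- Finite combinations of unit masses are dense, so identities between continuous linear maps need
-- only be checked on unit masses. All the algebra axioms and transfer statements rest on this.
theorem clm_ext {S T : ConvAlg ι →L[ℝ] E} (h : ∀ i, S (delta i) = T (delta i)) : S = T := by
  ext f
  have h1 := (hasSum_delta f).mapL S
  have h2 := (hasSum_delta f).mapL T
  simp only [map_smul, h] at h1 h2
  exact h1.unique h2

variable {G : Type*} [AddCommMonoid G]

/-- Convolution as a continuous bilinear map. -/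
def mulL : ConvAlg G →L[ℝ] ConvAlg G →L[ℝ] ConvAlg G :=
  extend (fun x => extend (fun y => delta (x + y)) fun _ => (norm_delta _).le)
    fun _ => norm_extend_le _ _

instance : Mul (ConvAlg G) := ⟨fun f g => mulL f g⟩
instance : One (ConvAlg G) := ⟨delta 0⟩

theorem one_def : (1 : ConvAlg G) = delta 0 := rfl
theorem mul_def (f g : ConvAlg G) : f * g = mulL f g := rfl

theorem mulL_delta (x y : G) : mulL (delta x) (delta y) = delta (x + y) := by
  simp [mulL]

theorem delta_mul_delta (x y : G) : (delta x * delta y : ConvAlg G) = delta (x + y) :=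
  mulL_delta x y

theorem norm_mulL_apply_le (f g : ConvAlg G) : ‖mulL f g‖ ≤ ‖f‖ * ‖g‖ :=
  ((mulL f).le_opNorm g).trans
    (mul_le_mul_of_nonneg_right (norm_extend_apply_le _ _ f) (norm_nonneg g))

theorem mulL_comm (f g : ConvAlg G) : mulL f g = mulL g f := by
  have h : mulL (G := G) = mulL.flip := by
    refine clm_ext fun x => clm_ext fun y => ?_
    simp [mulL_delta, add_comm]
  conv_lhs => rw [h]
  rfl

/-- Trilinear version of the density argument: the variables are released from unit masses one at a
time, last to first. -/
theorem mulL_assoc (f g k : ConvAlg G) : mulL (mulL f g) k = mulL f (mulL g k) := by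
  have h1 : ∀ x y : G, mulL (mulL (delta x) (delta y)) = mulL (delta x) ∘L mulL (delta y) :=
    fun x y => clm_ext fun z => by simp [mulL_delta, add_assoc]
  have h2 : ∀ (x : G) (k : ConvAlg G), mulL.flip k ∘L mulL (delta x) =
      mulL (delta x) ∘L mulL.flip k :=
    fun x k => clm_ext fun y => by simpa using DFunLike.congr_fun (h1 x y) k
  have h3 : mulL.flip k ∘L mulL.flip g = mulL.flip (mulL g k) :=
    clm_ext fun x => by simpa using DFunLike.congr_fun (h2 x k) g
  simpa using DFunLike.congr_fun h3 f

theorem one_mulL (f : ConvAlg G) : mulL (delta 0) f = f := by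
  have h : mulL (delta (0 : G)) = ContinuousLinearMap.id ℝ _ :=
    clm_ext fun x => by simp [mulL_delta]
  simp [h]

instance : NormedCommRing (ConvAlg G) where
  __ := (inferInstance : NormedAddCommGroup (ConvAlg G))
  mul_assoc := mulL_assoc
  mul_comm := mulL_comm
  one_mul := one_mulL
  mul_one f := (mulL_comm _ _).trans (one_mulL f)
  left_distrib f g k := map_add (mulL f) g k
  right_distrib f g k := by simp [mul_def]
  zero_mul f := by simp [mul_def]
  mul_zero f := by simp [mul_def]
  norm_mul_le := norm_mulL_apply_le

instance : NormOneClass (ConvAlg G) := ⟨norm_delta 0⟩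

instance : NormedAlgebra ℝ (ConvAlg G) where
  __ := Algebra.ofModule (R := ℝ) (A := ConvAlg G) (fun c f g => by simp [mul_def])
    (fun c f g => by simp [mul_def])
  norm_smul_le := norm_smul_le

/-- The algebra homomorphism `ℓ¹(G) → A` that extends a character of `G` in the unit ball. -/
def lift {A : Type*} [NormedCommRing A] [NormedAlgebra ℝ A] [CompleteSpace A] (u : G → A)
    (hu : ∀ x, ‖u x‖ ≤ 1) (h0 : u 0 = 1) (hadd : ∀ x y, u (x + y) = u x * u y) :
    ConvAlg G →ₐ[ℝ] A :=
  AlgHom.ofLinearMap (extend u hu).toLinearMap (by simp [one_def, h0]) (by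
    have h1 : ∀ x, extend u hu ∘L mulL (delta x) =
        ContinuousLinearMap.mul ℝ A (u x) ∘L extend u hu :=
      fun x => clm_ext fun y => by simp [mulL_delta, hadd]
    have h2 : ∀ g, extend u hu ∘L mulL.flip g =
        (ContinuousLinearMap.mul ℝ A).flip (extend u hu g) ∘L extend u hu :=
      fun g => clm_ext fun x => by simpa [mul_comm] using DFunLike.congr_fun (h1 x) g
    intro f g
    simpa [mul_comm, ← mul_def] using DFunLike.congr_fun (h2 g) f)

section lift

variable {A : Type*} [NormedCommRing A] [NormedAlgebra ℝ A] [CompleteSpace A] (u : G → A)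
    (hu : ∀ x, ‖u x‖ ≤ 1) (h0 : u 0 = 1) (hadd : ∀ x y, u (x + y) = u x * u y)

theorem lift_apply (f : ConvAlg G) : lift u hu h0 hadd f = extend u hu f := rfl

theorem lift_delta (x : G) : lift u hu h0 hadd (delta x) = u x := extend_delta u hu x

theorem norm_lift_le (f : ConvAlg G) : ‖lift u hu h0 hadd f‖ ≤ ‖f‖ := norm_extend_apply_le u hu f

theorem continuous_lift : Continuous (lift u hu h0 hadd) := (extend u hu).continuous

theorem lift_exp (f : ConvAlg G) :
    lift u hu h0 hadd (NormedSpace.exp f) = NormedSpace.exp (lift u hu h0 hadd f) := by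
  refine NormedSpace.map_exp_of_mem_ball (𝕂 := ℝ) _ (continuous_lift u hu h0 hadd) f ?_
  rw [NormedSpace.expSeries_radius_eq_top]
  exact edist_lt_top _ _

end lift

end ConvAlg

/-! ### Exponentials in Banach algebras and Poisson smoothing. -/

namespace BanachExp

open NormedSpace

variable {A : Type*} [NormedCommRing A] [NormedAlgebra ℝ A] [CompleteSpace A]

theorem exp_add_real (x y : A) : exp (x + y) = exp x * exp y :=
  let _ := NormedAlgebra.restrictScalars ℚ ℝ A
  exp_add

theorem exp_natCast_smul (n : ℕ) (x : A) : exp ((n : ℝ) • x) = exp x ^ n := by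
  let _ := NormedAlgebra.restrictScalars ℚ ℝ A
  rw [Nat.cast_smul_eq_nsmul, exp_nsmul]

theorem hasSum_exp (x : A) : HasSum (fun j : ℕ => (j.factorial : ℝ)⁻¹ • x ^ j) (exp x) :=
  exp_series_hasSum_exp' x

theorem hasSum_real_exp (r : ℝ) : HasSum (fun j : ℕ => (j.factorial : ℝ)⁻¹ * r ^ j) (Real.exp r) := by
  simpa [Real.exp_eq_exp_ℝ] using hasSum_exp r

theorem _root_.HasSum.congr_of_eq {ι V : Type*} [AddCommMonoid V] [TopologicalSpace V] {f g : ι → V}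
    {x y : V} (h : HasSum f x) (hf : ∀ j, g j = f j) (hx : y = x) : HasSum g y := by
  rwa [funext hf, hx]

theorem exp_smul_one (r : ℝ) : exp (r • (1 : A)) = Real.exp r • (1 : A) := by
  have h := hasSum_exp (r • (1 : A))
  refine h.unique (((hasSum_real_exp r).smul_const (1 : A)).congr_of_eq (fun j => ?_) rfl)
  simp [smul_pow, smul_smul]

variable [NormOneClass A]

theorem norm_exp_le (x : A) : ‖exp x‖ ≤ Real.exp ‖x‖ := by
  refine (hasSum_exp x).norm_le_of_bounded (hasSum_real_exp ‖x‖) fun j => ?_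
  rw [norm_smul, norm_inv, RCLike.norm_natCast]
  exact mul_le_mul_of_nonneg_left (norm_pow_le x j) (by positivity)

/-- The exponential of `R - r` is a contraction when `‖R‖ ≤ r`. -/
theorem norm_exp_sub_smul_one_le {R : A} {r : ℝ} (h : ‖R‖ ≤ r) : ‖exp (R - r • (1 : A))‖ ≤ 1 := by
  rw [sub_eq_add_neg R, ← neg_smul, exp_add_real, exp_smul_one, mul_smul_comm, mul_one, norm_smul,
    Real.norm_eq_abs, abs_of_pos (Real.exp_pos _)]
  calc Real.exp (-r) * ‖exp R‖ ≤ Real.exp (-r) * Real.exp r := by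
        gcongr
        exact (norm_exp_le R).trans (Real.exp_le_exp.2 h)
    _ = 1 := by rw [← Real.exp_add]; simp

theorem hasSum_shift {V : Type*} [NormedAddCommGroup V] [NormedSpace ℝ V] {f g : ℕ → V} {x y : V}
    (hg : HasSum g x) (h0 : f 0 = y) (hf : ∀ j, f (j + 1) = g j) : HasSum f (y + x) := by
  have h := (hasSum_nat_add_iff (f := f) 1).1 (by simpa [hf] using hg)
  simpa [h0, add_comm] using h

/-- First differences of Poisson weights: smoothing by the compound Poisson semigroup. -/
theorem norm_sub_one_mul_exp_le {U : A} (hU : ‖U‖ ≤ 1) {s : ℝ} (hs : 0 < s) :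
    ‖(U - 1) * exp (s • (U - 1))‖ ≤ 1 / √s := by
  set a : ℕ → ℝ := fun j => (j.factorial : ℝ)⁻¹ * s ^ j with ha
  have hrec : ∀ j : ℕ, ((j : ℝ) + 1) * a (j + 1) = s * a j := by
    intro j
    simp only [ha, Nat.factorial_succ, pow_succ]
    push_cast
    field_simp
  have h0 : HasSum a (Real.exp s) := hasSum_real_exp s
  have h1 : HasSum (fun j : ℕ => (j : ℝ) * a j) (0 + s * Real.exp s) :=
    hasSum_shift (h0.mul_left s) (by simp) fun j => by push_cast; exact hrec j
  have h2 : HasSum (fun j : ℕ => (j : ℝ) * ((j : ℝ) - 1) * a j)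
      (0 + s * (0 + s * Real.exp s)) :=
    hasSum_shift (h1.mul_left s) (by simp) fun j => by
      push_cast
      linear_combination (j : ℝ) * hrec j
  have hE : HasSum (fun j => a j • U ^ j) (exp (s • U)) := by
    convert hasSum_exp (s • U) using 2 with j
    rw [smul_pow, smul_smul]
  have hE1 : HasSum (fun j : ℕ => ((j : ℝ) / s * a j) • U ^ j) (0 + U * exp (s • U)) :=
    hasSum_shift (hE.mul_left U) (by simp) fun j => by
      have : ((j + 1 : ℕ) : ℝ) / s * a (j + 1) = a j := by
        push_cast
        field_simp
        linear_combination hrec j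
      rw [this, pow_succ', mul_smul_comm]
  -- Multiplying by U shifts the Poisson weights, and a (j - 1) = (j / s) a j, so differencing
  -- multiplies the j-th weight by j / s - 1.
  have hD : HasSum (fun j : ℕ => (((j : ℝ) / s - 1) * a j) • U ^ j) ((U - 1) * exp (s • U)) := by
    refine (hE1.sub hE).congr_of_eq (fun j => ?_) (by ring)
    rw [← sub_smul]; ring_nf
  have hsq : 0 < √s := Real.sqrt_pos.2 hs
  -- The majorant comes from 2|y| ≤ √s y² + 1/√s with y = j / s - 1. It sums to exp s / √s because
  -- the Poisson variance of j / s is 1 / s.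
  have hB : HasSum (fun j : ℕ => (√s * ((j : ℝ) / s - 1) ^ 2 + 1 / √s) / 2 * a j)
      (Real.exp s / √s) := by
    refine (((h2.mul_left (√s / s ^ 2)).add ((h1.mul_left (√s / s ^ 2 - 2 * √s / s)).add
      (h0.mul_left (√s + 1 / √s)))).div_const 2).congr_of_eq (fun j => ?_) ?_
    · field_simp; ring
    · field_simp; rw [Real.sq_sqrt hs.le]; ring
  have hn : ‖(U - 1) * exp (s • U)‖ ≤ Real.exp s / √s := by
    refine hD.norm_le_of_bounded hB fun j => ?_
    have haj : 0 ≤ a j := by positivity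
    rw [norm_smul, norm_mul, Real.norm_eq_abs, Real.norm_of_nonneg haj]
    have hUj : ‖U ^ j‖ ≤ 1 := (norm_pow_le U j).trans (pow_le_one₀ (norm_nonneg U) hU)
    have key : |(j : ℝ) / s - 1| ≤ (√s * ((j : ℝ) / s - 1) ^ 2 + 1 / √s) / 2 := by
      rw [← sq_abs]
      set y := |(j : ℝ) / s - 1|
      have : 0 ≤ (√s * y - 1) ^ 2 / √s := by positivity
      have e : (√s * y - 1) ^ 2 / √s = √s * y ^ 2 + 1 / √s - 2 * y := by field_simp; ring
      linarith
    calc |(j : ℝ) / s - 1| * a j * ‖U ^ j‖ ≤ |(j : ℝ) / s - 1| * a j * 1 := by gcongr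
      _ ≤ _ := by rw [mul_one]; gcongr
  have e : (U - 1) * exp (s • (U - 1)) = Real.exp (-s) • ((U - 1) * exp (s • U)) := by
    rw [smul_sub, sub_eq_add_neg (s • U), ← neg_smul, exp_add_real, exp_smul_one, mul_smul_comm,
      mul_one, mul_smul_comm]
  rw [e, norm_smul, Real.norm_of_nonneg (Real.exp_pos _).le]
  calc Real.exp (-s) * ‖(U - 1) * exp (s • U)‖ ≤ Real.exp (-s) * (Real.exp s / √s) := by gcongr
    _ = 1 / √s := by rw [← mul_div_assoc, ← Real.exp_add]; simp

/-- For the symmetrized shift `Δ = (U + U') / 2 - 1` with `U U' = 1`, the smoothing is of order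
`1 / b`. -/
theorem norm_symm_mul_exp_le {U U' : A} (hU : ‖U‖ ≤ 1) (hU' : ‖U'‖ ≤ 1) (h : U * U' = 1) {b : ℝ}
    (hb : 0 < b) :
    ‖((1 / 2 : ℝ) • (U + U') - 1) * exp (b • ((1 / 2 : ℝ) • (U + U') - 1))‖ ≤ 1 / b := by
  have e1 : b • ((1 / 2 : ℝ) • (U + U') - 1) = (b / 2) • (U - 1) + (b / 2) • (U' - 1) := by module
  -- The symmetrized increment is a product of two first differences; each takes half of the
  -- exponent and contributes 1/√(b/2).
  have e2 : (1 / 2 : ℝ) • (U + U') - 1 = (-(1 / 2) : ℝ) • ((U - 1) * (U' - 1)) := by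
    have : (U - 1) * (U' - 1) = (1 + 1 : ℝ) • 1 - (U + U') := by
      rw [add_smul, one_smul]; linear_combination h
    rw [this]; module
  rw [e1, exp_add_real, e2]
  have hs : 0 < b / 2 := by positivity
  have h1 := norm_sub_one_mul_exp_le hU hs
  have h2 := norm_sub_one_mul_exp_le hU' hs
  calc _ = ‖(-(1 / 2) : ℝ) • (((U - 1) * exp ((b / 2) • (U - 1))) *
        ((U' - 1) * exp ((b / 2) • (U' - 1))))‖ := by
        congr 1; rw [smul_mul_assoc]; congr 1; ring
    _ ≤ 1 / 2 * ((1 / √(b / 2)) * (1 / √(b / 2))) := by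
        rw [norm_smul]
        refine mul_le_mul (by norm_num) ((norm_mul_le _ _).trans ?_) (norm_nonneg _) (by norm_num)
        exact mul_le_mul h1 h2 (norm_nonneg _) (by positivity)
    _ = 1 / b := by
        rw [div_mul_div_comm, Real.mul_self_sqrt hs.le]; field_simp

end BanachExp

/-! ### The Bergström identity and the third-order error F - D. -/

namespace BanachExp

open NormedSpace

/-- Induction on n: multiply the identity by F = D + (F - D). Pascal's rule reassembles the
expansion, and the one term of order k + 1 left over is the new summand s = n on the right. -/
theorem bergstrom_identity {R : Type*} [CommRing R] (F D : R) (k n : ℕ) (hk : k ≤ n) :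
    F ^ n - ∑ m ∈ Finset.range (k + 1), (n.choose m : R) * (D ^ (n - m) * (F - D) ^ m) =
      (F - D) ^ (k + 1) *
        ∑ s ∈ Finset.Ico k n, (s.choose k : R) * (F ^ (n - 1 - s) * D ^ (s - k)) := by
  induction n, hk using Nat.le_induction with
  | base =>
    have h := add_pow (F - D) D k
    rw [sub_add_cancel] at h
    simp only [Finset.Ico_self, Finset.sum_empty, mul_zero]
    rw [h, sub_eq_zero]
    exact Finset.sum_congr rfl fun m _ => by ring
  | succ n hkn ih =>
    have e1 : F * ∑ m ∈ Finset.range (k + 1), (n.choose m : R) * (D ^ (n - m) * (F - D) ^ m) =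
        ∑ m ∈ Finset.range (k + 1), ((n + 1).choose m : R) * (D ^ (n + 1 - m) * (F - D) ^ m) +
          (n.choose k : R) * (D ^ (n - k) * (F - D) ^ (k + 1)) := by
      clear ih
      induction k with
      | zero => simp; ring
      | succ k ihk =>
        rw [Finset.sum_range_succ, mul_add, ihk (by omega), Finset.sum_range_succ _ (k + 1),
          Nat.choose_succ_succ]
        obtain ⟨r, rfl⟩ := Nat.exists_eq_add_of_le hkn
        rw [show k + 1 + r - k = r + 1 by omega, show k + 1 + r - (k + 1) = r by omega,
          show k + 1 + r + 1 - (k + 1) = r + 1 by omega]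
        push_cast
        ring
    have e2 : ∑ s ∈ Finset.Ico k (n + 1), (s.choose k : R) * (F ^ (n + 1 - 1 - s) * D ^ (s - k)) =
        F * ∑ s ∈ Finset.Ico k n, (s.choose k : R) * (F ^ (n - 1 - s) * D ^ (s - k)) +
          (n.choose k : R) * D ^ (n - k) := by
      rw [Finset.sum_Ico_succ_top hkn, Finset.mul_sum]
      congr 1
      · refine Finset.sum_congr rfl fun s hs => ?_
        have := Finset.mem_Ico.1 hs
        rw [show n + 1 - 1 - s = n - 1 - s + 1 by omega, pow_succ]
        ring
      · simp
    rw [e2]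
    linear_combination F * ih + e1

variable {A : Type*} [NormedCommRing A] [NormedAlgebra ℝ A] [CompleteSpace A]

/-- The third-order tail `∑ x ^ j / (j + 3)!` of the exponential series. -/
def expTail (x : A) : A := ∑' j : ℕ, ((j + 3).factorial : ℝ)⁻¹ • x ^ j

omit [CompleteSpace A] in
theorem norm_expTail_term_le [NormOneClass A] (x : A) (j : ℕ) :
    ‖((j + 3).factorial : ℝ)⁻¹ • x ^ j‖ ≤ (j.factorial : ℝ)⁻¹ * ‖x‖ ^ j := by
  rw [norm_smul, norm_inv, RCLike.norm_natCast]
  gcongr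
  · omega
  · exact norm_pow_le x j

omit [CompleteSpace A] in
theorem norm_expTail_le [NormOneClass A] (x : A) : ‖expTail x‖ ≤ Real.exp ‖x‖ :=
  tsum_of_norm_bounded (hasSum_real_exp ‖x‖) (norm_expTail_term_le x)

theorem exp_eq_expTail [NormOneClass A] (x : A) :
    exp x = 1 + x + (1 / 2 : ℝ) • x ^ 2 + x ^ 3 * expTail x := by
  have hs : Summable fun j : ℕ => ((j + 3).factorial : ℝ)⁻¹ • x ^ j :=
    Summable.of_norm_bounded (hasSum_real_exp ‖x‖).summable (norm_expTail_term_le x)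
  have h : HasSum _ (x ^ 3 * expTail x) := hs.hasSum.mul_left (x ^ 3)
  have h2 := (hasSum_nat_add_iff' 3).2 (hasSum_exp x)
  have h3 := h2.unique (h.congr_of_eq (fun j => by rw [mul_smul_comm, ← pow_add, add_comm 3 j]) rfl)
  rw [sub_eq_iff_eq_add] at h3
  rw [h3]
  simp only [Finset.sum_range_succ, Finset.sum_range_zero, Nat.factorial]
  simp
  ring

/-- The entire function `(1 + w - exp (w - w² / 2)) / w³`. -/
def hippFactor (w : A) : A :=
  (1 / 2 : ℝ) • 1 - (1 / 8 : ℝ) • w - (1 - (1 / 2 : ℝ) • w) ^ 3 * expTail (w - (1 / 2 : ℝ) • w ^ 2)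

/-- With x = w - w²/2 one has 1 + x + x²/2 = 1 + w - w³/2 + w⁴/8 and x³ = w³ (1 - w/2)³, so every
term of order below three cancels. -/
theorem one_add_sub_exp [NormOneClass A] (w : A) :
    1 + w - exp (w - (1 / 2 : ℝ) • w ^ 2) = w ^ 3 * hippFactor w := by
  rw [exp_eq_expTail, hippFactor]
  set T := expTail (w - (1 / 2 : ℝ) • w ^ 2)
  set h : A := (1 / 2 : ℝ) • 1 with hh
  have h2 : h + h = 1 := by rw [hh, ← add_smul]; norm_num
  have e1 : ∀ y : A, (1 / 2 : ℝ) • y = h * y := fun y => by simp [hh]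
  have e2 : (1 / 8 : ℝ) • w = h ^ 3 * w := by
    simp only [hh, smul_pow, one_pow, smul_mul_assoc, one_mul]; norm_num
  rw [e2, e1, e1, e1]
  linear_combination (h * w ^ 3) * h2

omit [CompleteSpace A] in
theorem norm_hippFactor_le [NormOneClass A] {w : A} (hw : ‖w‖ ≤ 2) :
    ‖hippFactor w‖ ≤ 1 + 8 * Real.exp 4 := by
  have h1 : ‖w - (1 / 2 : ℝ) • w ^ 2‖ ≤ 4 := by
    refine (norm_sub_le _ _).trans ?_
    rw [norm_smul]
    have : ‖w ^ 2‖ ≤ 2 ^ 2 := (norm_pow_le w 2).trans (by gcongr)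
    norm_num at this ⊢
    linarith
  have h2 : ‖1 - (1 / 2 : ℝ) • w‖ ≤ 2 := by
    refine (norm_sub_le _ _).trans ?_
    rw [norm_smul, norm_one]
    norm_num
    linarith
  have h3 : ‖(1 - (1 / 2 : ℝ) • w) ^ 3 * expTail (w - (1 / 2 : ℝ) • w ^ 2)‖ ≤
      2 ^ 3 * Real.exp 4 := by
    refine (norm_mul_le _ _).trans ?_
    gcongr
    · exact (norm_pow_le _ 3).trans (by gcongr)
    · exact (norm_expTail_le _).trans (Real.exp_le_exp.2 h1)
  have h4 : ‖(1 / 2 : ℝ) • (1 : A) - (1 / 8 : ℝ) • w‖ ≤ 1 := by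
    refine (norm_sub_le _ _).trans ?_
    rw [norm_smul, norm_smul, norm_one]
    norm_num
    linarith
  refine (norm_sub_le _ _).trans ?_
  linarith

end BanachExp

/-! ### Smoothing by a symmetric compound Poisson semigroup. -/

namespace ConvAlg

open NormedSpace BanachExp

variable {G : Type*} [AddCommGroup G]

omit [AddCommGroup G] in
-- On nonnegative weights the norm is the total mass, which is linear; this computes norms of
-- differences exactly.
theorem norm_eq_of_nonneg {f : ConvAlg G} (hf : ∀ x, 0 ≤ f x) :
    ‖f‖ = extend (fun _ : G => (1 : ℝ)) (fun _ => by simp) f := by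
  rw [← (hasSum_norm f).tsum_eq, extend_apply]
  exact tsum_congr fun x => by simp [abs_of_nonneg (hf x)]

/-- The symmetrized shift increment `(I_x + I_{-x}) / 2 - I`. -/
def symmDiffShift (x : G) : ConvAlg G := (1 / 2 : ℝ) • (delta x + delta (-x)) - 1

theorem norm_symmDiffShift_le (x : G) : ‖(symmDiffShift x : ConvAlg G)‖ ≤ 2 := by
  refine (norm_sub_le _ _).trans ?_
  rw [norm_smul, norm_one]
  have := norm_add_le (delta x : ConvAlg G) (delta (-x))
  rw [norm_delta, norm_delta] at this
  norm_num
  linarith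

variable {F : ConvAlg G} (h0 : ∀ x, 0 ≤ F x) (h1 : ‖F‖ = 1) (hs : ∀ x, F (-x) = F x)

omit [AddCommGroup G] in
include h0 h1 in
theorem hasSum_of_norm_eq_one : HasSum (fun x => F x) 1 := by
  have := hasSum_norm F
  rw [h1] at this
  exact this.congr_of_eq (fun x => (abs_of_nonneg (h0 x)).symm) rfl

include h0 h1 hs in
theorem hasSum_symmDiffShift : HasSum (fun x => F x • symmDiffShift x) (F - 1) := by
  have hA := hasSum_delta F
  have hB : HasSum (fun x => F x • (delta (-x) : ConvAlg G)) F := by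
    have := (Equiv.neg G).hasSum_iff.2 hA
    exact this.congr_of_eq (fun x => by simp [hs]) rfl
  have hC := (hasSum_of_norm_eq_one h0 h1).smul_const (1 : ConvAlg G)
  refine (((hA.add hB).const_smul (1 / 2 : ℝ)).sub hC).congr_of_eq (fun x => ?_) ?_
  · simp only [symmDiffShift]; module
  · module

include h0 h1 hs in
-- Only the atoms at x and -x do the smoothing. What remains of F after removing them is a
-- nonnegative R of mass at most 1 - F x, by symmetry, so its part of the exponential is a
-- contraction. The minimum combines the smoothing bound 1/(a F x) with the trivial bound 2.
theorem norm_symmDiffShift_mul_exp_le {a : ℝ} (ha : 0 < a) {x : G} :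
    F x * ‖symmDiffShift x * exp (a • (F - 1))‖ ≤ 1 / a * min 1 (2 * a * F x) := by
  classical
  set R : ConvAlg G := F - (F x / 2) • (delta x + delta (-x)) with hR
  have hR0 : ∀ y, 0 ≤ R y := by
    intro y
    have e : R y = F y - F x / 2 * ((if y = x then 1 else 0) + if y = -x then 1 else 0) := by
      simp only [hR, lp.coeFn_sub, lp.coeFn_smul, lp.coeFn_add, Pi.sub_apply, Pi.smul_apply,
        Pi.add_apply, delta_apply, smul_eq_mul]
    rw [e]
    have hx := h0 x
    have hy := h0 y
    split_ifs with c1 c2 c2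
    · subst c1; linarith
    · subst c1; linarith
    · subst c2; rw [hs]; linarith
    · linarith
  have hRn : ‖R‖ ≤ 1 - F x := by
    rw [norm_eq_of_nonneg hR0, hR, map_sub, map_smul, map_add, extend_delta, extend_delta,
      ← norm_eq_of_nonneg h0, h1, smul_eq_mul]
    linarith
  have e : a • (F - 1) = (a * F x) • symmDiffShift x + (a • R - (a * (1 - F x)) • 1) := by
    simp only [hR, symmDiffShift]; module
  have hle : ‖symmDiffShift x * exp (a • (F - 1))‖ ≤
      ‖symmDiffShift x * exp ((a * F x) • symmDiffShift x)‖ := by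
    rw [e, exp_add_real, ← mul_assoc]
    refine (norm_mul_le _ _).trans (mul_le_of_le_one_right (norm_nonneg _) ?_)
    refine norm_exp_sub_smul_one_le ?_
    rw [norm_smul, Real.norm_of_nonneg ha.le]
    gcongr
  rcases (h0 x).eq_or_lt with hx | hx
  · simp [← hx]
  have hd : (delta x * delta (-x) : ConvAlg G) = 1 := by rw [delta_mul_delta, add_neg_cancel]; rfl
  have b1 : ‖symmDiffShift x * exp ((a * F x) • symmDiffShift x)‖ ≤ 1 / (a * F x) :=
    norm_symm_mul_exp_le (norm_delta x).le (norm_delta (-x)).le hd (by positivity)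
  have b2 : ‖symmDiffShift x * exp ((a * F x) • symmDiffShift x)‖ ≤ 2 := by
    refine (norm_mul_le _ _).trans ?_
    have : ‖exp ((a * F x) • (symmDiffShift x : ConvAlg G))‖ ≤ 1 := by
      rw [symmDiffShift, smul_sub]
      refine norm_exp_sub_smul_one_le ?_
      rw [norm_smul, norm_smul, Real.norm_of_nonneg (by positivity)]
      have := norm_add_le (delta x : ConvAlg G) (delta (-x))
      rw [norm_delta, norm_delta] at this
      refine mul_le_of_le_one_right (by positivity) ?_
      norm_num
      linarith
    nlinarith [norm_symmDiffShift_le x, norm_nonneg (exp ((a * F x) • (symmDiffShift x : ConvAlg G)))]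
  rw [mul_min_of_nonneg _ _ (by positivity), le_min_iff]
  constructor
  · calc _ ≤ F x * (1 / (a * F x)) := by gcongr; exact hle.trans b1
      _ = _ := by field_simp
  · calc _ ≤ F x * 2 := by gcongr; exact hle.trans b2
      _ = _ := by field_simp

/-- Smoothing of the centred distribution by the compound Poisson semigroup, in terms of the sum
of the truncated jump intensities. -/
theorem norm_sub_one_mul_exp_le (hF0 : ∀ x, 0 ≤ F x) (hF1 : ‖F‖ = 1) (hFs : ∀ x, F (-x) = F x)
    {a y : ℝ} (ha : 0 < a) (hy : 2 * a ≤ y) :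
    ‖(F - 1) * exp (a • (F - 1))‖ ≤ 1 / a * ∑' x : {x : G // x ≠ 0}, min 1 (y * F x) := by
  have hsum : Summable fun x : G => min 1 (y * F x) := by
    refine Summable.of_nonneg_of_le (fun x => ?_) (fun x => min_le_right _ _)
      ((hasSum_of_norm_eq_one hF0 hF1).summable.mul_left y)
    have := hF0 x
    have : 0 ≤ y := by linarith
    positivity
  have hs' : Summable fun x : {x : G // x ≠ 0} => min 1 (y * F x) :=
    hsum.subtype {x : G | x ≠ 0}
  have h := (hasSum_symmDiffShift hF0 hF1 hFs).mul_right (exp (a • (F - 1)))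
  have h' : HasSum (fun x : {x : G // x ≠ 0} => (F x • symmDiffShift (x : G)) * exp (a • (F - 1)))
      ((F - 1) * exp (a • (F - 1))) := by
    -- The atom at the origin contributes nothing, since its increment vanishes.
    refine (hasSum_subtype_iff_of_support_subset (s := {x : G | x ≠ 0}) ?_).2 h
    intro x hx hx0
    apply hx
    subst hx0
    have : (symmDiffShift 0 : ConvAlg G) = 0 := by
      rw [symmDiffShift, neg_zero, ← one_def]; module
    simp [this]
  rw [← tsum_mul_left]
  refine h'.norm_le_of_bounded (hs'.mul_left (1 / a)).hasSum fun x => ?_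
  rw [smul_mul_assoc, norm_smul, Real.norm_of_nonneg (hF0 _)]
  refine (norm_symmDiffShift_mul_exp_le hF0 hF1 hFs ha).trans ?_
  have := hF0 x
  gcongr

end ConvAlg

/-! ### Coefficient norms of power series from their values on the unit circle. -/

namespace ConvAlg

open Complex intervalIntegral

/-- Evaluation of an absolutely convergent power series at the point `e^{it}` of the unit circle. -/
def evalCircle (t : ℝ) : ConvAlg ℕ →ₐ[ℝ] ℂ :=
  lift (fun j : ℕ => cexp (t * I) ^ j) (fun j => by simp) (pow_zero _) (pow_add _)

theorem evalCircle_delta_one (t : ℝ) : evalCircle t (delta 1) = cexp (t * I) := by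
  rw [evalCircle, lift_delta, pow_one]

theorem evalCircle_exp (t : ℝ) (f : ConvAlg ℕ) :
    evalCircle t (NormedSpace.exp f) = cexp (evalCircle t f) := by
  have h := lift_exp (fun j : ℕ => cexp (t * I) ^ j) (fun j => by simp) (pow_zero _) (pow_add _) f
  exact h.trans (congrFun Complex.exp_eq_exp_ℂ.symm _)

theorem hasSum_evalCircle (t : ℝ) (f : ConvAlg ℕ) :
    HasSum (fun j : ℕ => f j • cexp (t * I) ^ j) (evalCircle t f) :=
  hasSum_extend (fun j : ℕ => cexp (t * I) ^ j) (fun j => by simp) f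

theorem neg_pi_lt_pi : -Real.pi < Real.pi := neg_lt_self Real.pi_pos

theorem fourierCoeffOn_pi (f : ℝ → ℂ) (n : ℤ) :
    fourierCoeffOn neg_pi_lt_pi f n =
      (1 / (2 * Real.pi) : ℝ) • ∫ t in (-Real.pi)..Real.pi, cexp (-(n * t * I)) * f t := by
  rw [fourierCoeffOn_eq_integral]
  congr 1
  · congr 1; ring
  · refine intervalIntegral.integral_congr fun t _ => ?_
    simp only [fourier_coe_apply, smul_eq_mul]
    congr 2
    have : (Real.pi : ℂ) ≠ 0 := by exact_mod_cast Real.pi_ne_zero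
    push_cast
    field_simp
    ring

theorem integral_exp_int_mul (m : ℤ) :
    ∫ t in (-Real.pi)..Real.pi, cexp (m * t * I) = if m = 0 then (2 * Real.pi : ℂ) else 0 := by
  split_ifs with h
  · subst h
    simp
    ring
  · have hm : (m : ℂ) * I ≠ 0 := by simp [h]
    have e : ∀ t : ℝ, cexp (m * t * I) = cexp (m * I * t) := fun t => by ring_nf
    simp_rw [e]
    rw [integral_exp_mul_complex hm, div_eq_zero_iff]
    left
    rw [sub_eq_zero, Complex.exp_eq_exp_iff_exists_int]
    exact ⟨m, by push_cast; ring⟩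

theorem fourierCoeffOn_evalCircle (g : ConvAlg ℕ) (n : ℕ) :
    fourierCoeffOn neg_pi_lt_pi (fun t => evalCircle t g) n = g n := by
  have hs : ∀ t : ℝ, HasSum (fun j : ℕ => cexp (-((n : ℤ) * t * I)) * (g j • cexp (t * I) ^ j))
      (cexp (-((n : ℤ) * t * I)) * evalCircle t g) := fun t =>
    (hasSum_evalCircle t g).mul_left _
  have hI := intervalIntegral.hasSum_integral_of_dominated_convergence
    (μ := volume) (a := -Real.pi) (b := Real.pi)
    (F := fun (j : ℕ) (t : ℝ) => cexp (-((n : ℤ) * t * I)) * (g j • cexp (t * I) ^ j))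
    (f := fun t => cexp (-((n : ℤ) * t * I)) * evalCircle t g)
    (fun j _ => |g j|)
    (fun j => by
      refine Continuous.aestronglyMeasurable ?_
      fun_prop)
    (fun j => ae_of_all _ fun t _ => by
      have e : ‖cexp (-((n : ℤ) * t * I))‖ = 1 := by
        rw [show -(((n : ℤ) : ℂ) * t * I) = ((-(n * t) : ℝ) : ℂ) * I by push_cast; ring]
        exact norm_exp_ofReal_mul_I _
      rw [norm_mul, e, norm_smul, norm_pow, norm_exp_ofReal_mul_I]
      simp)
    (ae_of_all _ fun t _ => (hasSum_norm g).summable)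
    (by simp)
    (ae_of_all _ fun t _ => hs t)
  have hterm : ∀ j : ℕ, ∫ t in (-Real.pi)..Real.pi,
      cexp (-((n : ℤ) * t * I)) * (g j • cexp (t * I) ^ j) =
      if j = n then (g n : ℂ) * (2 * Real.pi) else 0 := by
    intro j
    have e : ∀ t : ℝ, cexp (-((n : ℤ) * t * I)) * (g j • cexp (t * I) ^ j) =
        (g j : ℂ) * cexp (((j - n : ℤ) : ℂ) * t * I) := by
      intro t
      rw [real_smul, ← Complex.exp_nat_mul, mul_left_comm, ← Complex.exp_add]
      congr 2
      push_cast; ring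
    simp_rw [e]
    rw [intervalIntegral.integral_const_mul, integral_exp_int_mul]
    by_cases h : j = n
    · simp [h]
    · have : ¬ ((j : ℤ) - n = 0) := by omega
      simp [h, this]
  rw [fourierCoeffOn_pi]
  simp_rw [hterm] at hI
  have h2 := hI.unique (hasSum_ite_eq n ((g n : ℂ) * (2 * Real.pi)))
  rw [h2]
  have : (Real.pi : ℂ) ≠ 0 := by exact_mod_cast Real.pi_ne_zero
  rw [real_smul]
  push_cast
  field_simp

/-- Integration by parts, with no boundary term by periodicity. Subtracting i c f recentres the
multiplier from n to n - c. -/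
theorem fourierCoeffOn_deriv {f f' : ℝ → ℂ} (hf : ∀ t, HasDerivAt f (f' t) t) (hf' : Continuous f')
    (hp : f Real.pi = f (-Real.pi)) (c : ℝ) (n : ℕ) :
    fourierCoeffOn neg_pi_lt_pi (fun t => f' t - I * c * f t) n =
      I * (n - c) * fourierCoeffOn neg_pi_lt_pi f n := by
  have hfc : Continuous f := continuous_iff_continuousAt.2 fun t => (hf t).continuousAt
  rw [fourierCoeffOn_pi, fourierCoeffOn_pi, mul_smul_comm, ← intervalIntegral.integral_const_mul,
    ← sub_eq_zero, ← smul_sub, ← intervalIntegral.integral_sub]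
  · have hd : ∀ t : ℝ, HasDerivAt (fun t : ℝ => cexp (-((n : ℤ) * t * I)) * f t)
        (cexp (-((n : ℤ) * t * I)) * (f' t - I * c * f t) -
          I * (n - c) * (cexp (-((n : ℤ) * t * I)) * f t)) t := by
      intro t
      have h1 : HasDerivAt (fun t : ℝ => -(((n : ℤ) : ℂ) * t * I)) (-((n : ℤ) * I)) t := by
        have := (((hasDerivAt_id (t : ℂ)).const_mul ((n : ℤ) : ℂ)).mul_const I).neg.comp_ofReal
        simpa using this
      refine (h1.cexp.mul (hf t)).congr_deriv ?_
      push_cast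
      ring
    rw [intervalIntegral.integral_eq_sub_of_hasDerivAt (fun t _ => hd t)]
    · rw [hp]
      have : cexp (-((n : ℤ) * (Real.pi : ℝ) * I)) = cexp (-((n : ℤ) * (-Real.pi : ℝ) * I)) := by
        rw [Complex.exp_eq_exp_iff_exists_int]
        exact ⟨-n, by push_cast; ring⟩
      rw [this]
      simp
    · exact Continuous.intervalIntegrable (by fun_prop) _ _
  · exact Continuous.intervalIntegrable (by fun_prop) _ _
  · exact Continuous.intervalIntegrable (by fun_prop) _ _

theorem bessel_fourierCoeffOn {f : ℝ → ℂ} (hf : Continuous f) (n : ℕ) :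
    ∑ j ∈ Finset.range n, ‖fourierCoeffOn neg_pi_lt_pi f j‖ ^ 2 ≤
      (2 * Real.pi)⁻¹ * ∫ t in (-Real.pi)..Real.pi, ‖f t‖ ^ 2 := by
  have hL : MemLp f 2 (volume.restrict (Ioc (-Real.pi) Real.pi)) := by
    obtain ⟨C, hC⟩ := isCompact_Icc.exists_bound_of_continuousOn
      (hf.continuousOn (s := Icc (-Real.pi) Real.pi))
    exact MemLp.of_bound hf.aestronglyMeasurable C
      ((ae_restrict_mem measurableSet_Ioc).mono fun x hx => hC x (Ioc_subset_Icc_self hx))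
  have h := hasSum_sq_fourierCoeffOn neg_pi_lt_pi hL
  have h2 := sum_le_hasSum ((Finset.range n).map Nat.castEmbedding) (fun _ _ => by positivity) h
  rw [Finset.sum_map] at h2
  rw [smul_eq_mul, sub_neg_eq_add, ← two_mul] at h2
  exact h2

/-- Comparison with the telescoping increments of l arctan((x - c)/l), whose total is at most π l.
The factor 3 comes from 1 + (u + v)² ≤ 3(1 + v²) for 0 ≤ u ≤ 1; the step u is at most 1 because l ≥
1. -/
theorem sum_inv_one_add_sq_le (c : ℝ) {l : ℝ} (hl : 1 ≤ l) (n : ℕ) :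
    ∑ j ∈ Finset.range n, (1 + ((j - c) / l) ^ 2)⁻¹ ≤ 3 * Real.pi * l := by
  have hl0 : 0 < l := by linarith
  set Φ : ℝ → ℝ := fun x => l * Real.arctan ((x - c) / l) with hΦ
  have hd : ∀ x, HasDerivAt Φ ((1 + ((x - c) / l) ^ 2)⁻¹) x := by
    intro x
    have h1 : HasDerivAt (fun x : ℝ => (x - c) / l) (1 / l) x :=
      ((hasDerivAt_id x).sub_const c).div_const l
    refine ((h1.arctan).const_mul l).congr_deriv ?_
    field_simp
  have hstep : ∀ j : ℕ, (1 + ((j - c) / l) ^ 2)⁻¹ ≤ 3 * (Φ ((j + 1 : ℕ) : ℝ) - Φ j) := by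
    intro j
    obtain ⟨x, hx, he⟩ := exists_hasDerivAt_eq_slope Φ (fun x => (1 + ((x - c) / l) ^ 2)⁻¹)
      (show (j : ℝ) < ((j + 1 : ℕ) : ℝ) by push_cast; linarith)
      (fun x _ => (hd x).continuousAt.continuousWithinAt) (fun x _ => hd x)
    have e : Φ ((j + 1 : ℕ) : ℝ) - Φ j = (1 + ((x - c) / l) ^ 2)⁻¹ := by
      rw [he]; push_cast; ring
    rw [e, ← div_eq_mul_inv, inv_eq_one_div, div_le_div_iff₀ (by positivity) (by positivity)]
    have hx1 : 0 ≤ (x - j) / l := div_nonneg (by linarith [hx.1]) hl0.le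
    have hx2 : (x - j) / l ≤ 1 := by
      rw [div_le_one hl0]; have := hx.2; push_cast at this; linarith
    have e2 : (x - c) / l = (x - j) / l + (j - c) / l := by ring
    rw [e2]
    set u := (x - j) / l
    set v := ((j : ℝ) - c) / l
    nlinarith [sq_nonneg (u - v)]
  calc _ ≤ ∑ j ∈ Finset.range n, 3 * (Φ ((j + 1 : ℕ) : ℝ) - Φ j) :=
        Finset.sum_le_sum fun j _ => hstep j
    _ = 3 * (Φ (n : ℕ) - Φ (0 : ℕ)) := by
        rw [← Finset.mul_sum, Finset.sum_range_sub (fun j : ℕ => Φ j)]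
    _ ≤ 3 * Real.pi * l := by
        simp only [hΦ]
        have h1 := Real.arctan_lt_pi_div_two (((n : ℕ) - c) / l)
        have h2 := Real.neg_pi_div_two_lt_arctan (((0 : ℕ) - c) / l)
        nlinarith

/-- For large N, the bound 1 - cos t ≥ 2t²/π² on [-π, π] reduces to a Gaussian integral; for small N
the integrand is simply at most 1. -/
theorem integral_exp_neg_one_sub_cos_le {N : ℝ} (hN : 0 ≤ N) :
    (2 * Real.pi)⁻¹ * ∫ t in (-Real.pi)..Real.pi, Real.exp (-(N / 2 * (1 - Real.cos t))) ≤
      1 / max 1 (√N) := by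
  have hpi := Real.pi_pos
  have hcont : Continuous fun t : ℝ => Real.exp (-(N / 2 * (1 - Real.cos t))) := by fun_prop
  have b1 : (2 * Real.pi)⁻¹ * ∫ t in (-Real.pi)..Real.pi,
      Real.exp (-(N / 2 * (1 - Real.cos t))) ≤ 1 := by
    have : ∫ t in (-Real.pi)..Real.pi, Real.exp (-(N / 2 * (1 - Real.cos t))) ≤
        ∫ t in (-Real.pi)..Real.pi, (1 : ℝ) := by
      refine intervalIntegral.integral_mono_on neg_pi_lt_pi.le (hcont.intervalIntegrable _ _)
        (by simp) fun t _ => ?_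
      rw [Real.exp_le_one_iff]
      have := Real.cos_le_one t
      have : 0 ≤ N / 2 * (1 - Real.cos t) := mul_nonneg (by linarith) (by linarith)
      linarith
    rw [intervalIntegral.integral_const, smul_eq_mul, mul_one] at this
    rw [inv_mul_le_iff₀ (by positivity)]
    linarith
  rcases le_or_gt (√N) 1 with h | h
  · rw [max_eq_left h]; simpa using b1
  have hN0 : 0 < N := by
    rcases hN.eq_or_lt with h0 | h0
    · rw [← h0] at h; simp at h; linarith
    · exact h0
  rw [max_eq_right h.le]
  have hg : Integrable fun t : ℝ => Real.exp (-(N / Real.pi ^ 2) * t ^ 2) :=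
    integrable_exp_neg_mul_sq (by positivity)
  have b2 : ∫ t in (-Real.pi)..Real.pi, Real.exp (-(N / 2 * (1 - Real.cos t))) ≤
      ∫ t : ℝ, Real.exp (-(N / Real.pi ^ 2) * t ^ 2) := by
    calc _ ≤ ∫ t in (-Real.pi)..Real.pi, Real.exp (-(N / Real.pi ^ 2) * t ^ 2) := by
          refine intervalIntegral.integral_mono_on neg_pi_lt_pi.le (hcont.intervalIntegrable _ _)
            hg.intervalIntegrable fun t ht => ?_
          have hc := Real.cos_le_one_sub_mul_cos_sq (x := t) (abs_le.2 ht)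
          rw [Real.exp_le_exp, neg_mul, neg_le_neg_iff]
          calc N / Real.pi ^ 2 * t ^ 2 = N / 2 * (2 / Real.pi ^ 2 * t ^ 2) := by ring
            _ ≤ _ := by gcongr; linarith
      _ ≤ _ := by
          rw [intervalIntegral.integral_of_le neg_pi_lt_pi.le]
          exact setIntegral_le_integral hg (ae_of_all _ fun t => (Real.exp_pos _).le)
  rw [integral_gaussian] at b2
  have e : √(Real.pi / (N / Real.pi ^ 2)) = Real.pi * √Real.pi / √N := by
    rw [show Real.pi / (N / Real.pi ^ 2) = Real.pi ^ 2 * Real.pi / N by field_simp,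
      Real.sqrt_div (by positivity), Real.sqrt_mul (by positivity), Real.sqrt_sq hpi.le]
  rw [e] at b2
  have h4 : √Real.pi ≤ 2 := by
    rw [Real.sqrt_le_left (by norm_num)]; linarith [Real.pi_le_four]
  calc _ ≤ (2 * Real.pi)⁻¹ * (Real.pi * √Real.pi / √N) := by gcongr
    _ = √Real.pi / 2 * (1 / √N) := by field_simp
    _ ≤ 1 * (1 / √N) := by gcongr; linarith
    _ = _ := one_mul _

/-- A Bernstein–Beurling type bound of the `ℓ¹` norm of the coefficients of a power series by its
values and centred derivative on the unit circle. -/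
theorem norm_sq_le_of_circle (g : ConvAlg ℕ) {f f' : ℝ → ℂ} (hg : ∀ t, evalCircle t g = f t)
    (hf : ∀ t, HasDerivAt f (f' t) t) (hf' : Continuous f') (c : ℝ) {N Q : ℝ} (hN : 0 ≤ N)
    (hQ : 1 ≤ Q) (h1 : ∀ t, ‖f t‖ ^ 2 ≤ Real.exp (-(N / 2 * (1 - Real.cos t))))
    (h2 : ∀ t, ‖f' t - I * c * f t‖ ^ 2 ≤ Q * N * Real.exp (-(N / 2 * (1 - Real.cos t)))) :
    ‖g‖ ^ 2 ≤ 6 * Real.pi * Q := by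
  have hpi := Real.pi_pos
  have hfc : Continuous f := continuous_iff_continuousAt.2 fun t => (hf t).continuousAt
  -- The coefficients are expected to spread over a window of width about √N around c, but never
  -- less than 1.
  set l := max 1 (√N) with hl
  have hl1 : 1 ≤ l := le_max_left _ _
  have hl0 : 0 < l := by linarith
  have hNl : N ≤ l ^ 2 := by
    rw [← Real.sq_sqrt hN]
    exact pow_le_pow_left₀ (Real.sqrt_nonneg _) (le_max_right _ _) 2
  have hfg : f = fun t => evalCircle t g := (funext hg).symm
  have hcoef : ∀ n : ℕ, fourierCoeffOn neg_pi_lt_pi f n = g n := by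
    intro n; rw [hfg]; exact fourierCoeffOn_evalCircle g n
  have hper : f Real.pi = f (-Real.pi) := by
    have e : cexp ((Real.pi : ℝ) * I) = cexp ((-Real.pi : ℝ) * I) := by
      rw [Complex.exp_eq_exp_iff_exists_int]
      exact ⟨1, by push_cast; ring⟩
    rw [← hg, ← hg]
    simp only [evalCircle, lift_apply, extend_apply, e]
  set J := (2 * Real.pi)⁻¹ * ∫ t in (-Real.pi)..Real.pi, Real.exp (-(N / 2 * (1 - Real.cos t)))
    with hJ
  have hJl : J ≤ 1 / l := integral_exp_neg_one_sub_cos_le hN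
  have hcont : Continuous fun t : ℝ => Real.exp (-(N / 2 * (1 - Real.cos t))) := by fun_prop
  have B1 : ∀ n, ∑ j ∈ Finset.range n, g j ^ 2 ≤ J := by
    intro n
    have := bessel_fourierCoeffOn hfc n
    simp_rw [hcoef, norm_real, Real.norm_eq_abs, sq_abs] at this
    refine this.trans ?_
    rw [hJ]
    gcongr
    exact intervalIntegral.integral_mono_on neg_pi_lt_pi.le
      (Continuous.intervalIntegrable (by fun_prop) _ _) (hcont.intervalIntegrable _ _)
      fun t _ => h1 t
  have B2 : ∀ n, ∑ j ∈ Finset.range n, ((j - c) * g j) ^ 2 ≤ Q * N * J := by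
    intro n
    have := bessel_fourierCoeffOn (f := fun t => f' t - I * c * f t) (by fun_prop) n
    have e : ∀ j : ℕ, ‖fourierCoeffOn neg_pi_lt_pi (fun t => f' t - I * c * f t) j‖ ^ 2 =
        ((j - c) * g j) ^ 2 := by
      intro j
      rw [fourierCoeffOn_deriv hf hf' hper, hcoef, norm_mul, norm_mul, norm_I, one_mul, mul_pow,
        mul_pow, norm_real, Real.norm_eq_abs, sq_abs]
      congr 1
      rw [← ofReal_natCast, ← ofReal_sub, norm_real, Real.norm_eq_abs, sq_abs]
    simp_rw [e] at this
    refine this.trans ?_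
    rw [hJ, mul_left_comm]
    refine mul_le_mul_of_nonneg_left ?_ (inv_nonneg.2 (mul_nonneg two_pos.le hpi.le))
    rw [← intervalIntegral.integral_const_mul]
    exact intervalIntegral.integral_mono_on neg_pi_lt_pi.le
      (Continuous.intervalIntegrable (by fun_prop) _ _)
      (Continuous.intervalIntegrable (by fun_prop) _ _) fun t _ => h2 t
  have B3 : ∀ n, (∑ j ∈ Finset.range n, |g j|) ^ 2 ≤ 6 * Real.pi * Q := by
    intro n
    have hpos : ∀ j : ℕ, 0 < 1 + (((j : ℕ) - c) / l) ^ 2 := fun j => by positivity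
    -- Cauchy–Schwarz with weight 1 + ((j - c)/l)²: the inverse weights sum to O(l) and the weighted
    -- squares to O(Q/l), so l cancels.
    have cs := Finset.sum_sq_le_sum_mul_sum_of_sq_le_mul (Finset.range n)
      (r := fun j => |g j|) (f := fun j => (1 + (((j : ℕ) - c) / l) ^ 2)⁻¹)
      (g := fun j => (1 + (((j : ℕ) - c) / l) ^ 2) * g j ^ 2)
      (fun j _ => by positivity) (fun j _ => by positivity)
      (fun j _ => by rw [sq_abs, inv_mul_cancel_left₀ (hpos j).ne'])
    refine cs.trans ?_
    have e : ∑ j ∈ Finset.range n, (1 + (((j : ℕ) - c) / l) ^ 2) * g j ^ 2 =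
        ∑ j ∈ Finset.range n, g j ^ 2 + (1 / l ^ 2) * ∑ j ∈ Finset.range n, ((j - c) * g j) ^ 2 := by
      rw [Finset.mul_sum, ← Finset.sum_add_distrib]
      exact Finset.sum_congr rfl fun j _ => by field_simp
    have hJ0 : 0 ≤ J := (Finset.sum_nonneg (s := Finset.range 0) (f := fun j => g j ^ 2)
      fun j _ => sq_nonneg _).trans (B1 0)
    have b : ∑ j ∈ Finset.range n, (1 + (((j : ℕ) - c) / l) ^ 2) * g j ^ 2 ≤ 2 * Q * (1 / l) := by
      rw [e]
      calc _ ≤ J + (1 / l ^ 2) * (Q * N * J) := by gcongr; exacts [B1 n, B2 n]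
        _ = J * (1 + Q * (N / l ^ 2)) := by ring
        _ ≤ (1 / l) * (1 + Q * 1) := by
            gcongr
            rw [div_le_one (by positivity)]; exact hNl
        _ ≤ (1 / l) * (2 * Q) := by gcongr; linarith
        _ = _ := by ring
    calc _ ≤ (3 * Real.pi * l) * (2 * Q * (1 / l)) := by
          refine mul_le_mul (sum_inv_one_add_sq_le c hl1 n) b (Finset.sum_nonneg fun j _ =>
            mul_nonneg (hpos j).le (sq_nonneg _)) (by positivity)
      _ = _ := by field_simp; ring
  have ht := ((hasSum_norm g).tendsto_sum_nat).pow 2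
  exact le_of_tendsto' ht B3

end ConvAlg

/-! ### Uniform bounds for the factors left over from F^a and D^b. -/

namespace ConvAlg

open Complex

section circle

variable (p t : ℝ)

/-- The value at `e^{it}` of the power series `p (X - 1)`. -/
def circleIncr : ℂ := p * (cexp (t * I) - 1)

theorem evalCircle_smul_delta_sub_one :
    evalCircle t (p • (delta 1 - 1)) = circleIncr p t := by
  rw [map_smul, map_sub, map_one, evalCircle_delta_one, real_smul, circleIncr]

theorem circleIncr_re : (circleIncr p t).re = -(p * (1 - Real.cos t)) := by
  rw [circleIncr, re_ofReal_mul, sub_re, exp_ofReal_mul_I_re, one_re]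
  ring

theorem circleIncr_im : (circleIncr p t).im = p * Real.sin t := by
  rw [circleIncr, im_ofReal_mul, sub_im, exp_ofReal_mul_I_im, one_im]
  ring

theorem norm_sq_circleIncr : ‖circleIncr p t‖ ^ 2 = 2 * p ^ 2 * (1 - Real.cos t) := by
  rw [← normSq_eq_norm_sq, normSq_apply, circleIncr_re, circleIncr_im]
  linear_combination p ^ 2 * Real.sin_sq_add_cos_sq t

theorem norm_sq_one_add_circleIncr :
    ‖1 + circleIncr p t‖ ^ 2 = 1 - 2 * p * (1 - p) * (1 - Real.cos t) := by
  rw [← normSq_eq_norm_sq, normSq_apply, add_re, add_im, circleIncr_re, circleIncr_im, one_re,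
    one_im]
  linear_combination p ^ 2 * Real.sin_sq_add_cos_sq t

theorem circleIncr_sq_re :
    (circleIncr p t ^ 2).re = -(2 * p ^ 2 * (1 - Real.cos t) * Real.cos t) := by
  rw [pow_two, mul_re, circleIncr_re, circleIncr_im]
  linear_combination -p ^ 2 * Real.sin_sq_add_cos_sq t

theorem hasDerivAt_circleIncr : HasDerivAt (circleIncr p) (I * (p + circleIncr p t)) t := by
  have h := (((hasDerivAt_id (t : ℂ)).mul_const I).cexp.sub_const 1).const_mul (p : ℂ)
  have h2 := h.comp_ofReal
  refine h2.congr_deriv ?_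
  simp only [circleIncr, id_eq]
  ring

theorem continuous_circleIncr : Continuous (circleIncr p) :=
  continuous_iff_continuousAt.2 fun t => (hasDerivAt_circleIncr p t).continuousAt

end circle

theorem mul_exp_neg_half_le_one (x : ℝ) : x * Real.exp (-(x / 2)) ≤ 1 := by
  have h1 : x / 4 + 1 ≤ Real.exp (x / 4) := Real.add_one_le_exp _
  have h2 : x ≤ Real.exp (x / 2) := by
    rcases le_or_gt x 0 with h | h
    · exact h.trans (Real.exp_pos _).le
    · have e : Real.exp (x / 2) = Real.exp (x / 4) ^ 2 := by
        rw [← Real.exp_nat_mul]; congr 1; push_cast; ring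
      have h3 : (x / 4 + 1) ^ 2 ≤ Real.exp (x / 4) ^ 2 := by gcongr
      rw [e]
      nlinarith [sq_nonneg (x / 4 - 1)]
  rw [Real.exp_neg]
  exact (div_le_one (Real.exp_pos _)).2 h2

theorem mul_exp_neg_le_exp_neg_half (x : ℝ) :
    x * Real.exp (-x) ≤ Real.exp (-(x / 2)) := by
  have e : Real.exp (-x) = Real.exp (-(x / 2)) * Real.exp (-(x / 2)) := by
    rw [← Real.exp_add]; ring_nf
  rw [e, ← mul_assoc]
  exact mul_le_of_le_one_left (Real.exp_pos _).le (mul_exp_neg_half_le_one x)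

variable {p q : ℝ} (hp : 0 < p) (hq : 0 < q) (hpq : p + q = 1)

include hp hq hpq

/-- Powers of the binomial factor `q + p X` with half of its Poisson part removed have uniformly
bounded coefficient norm. -/
theorem norm_sq_binomial_factor_le (a : ℕ) :
    ‖((1 + p • (delta 1 - 1)) ^ a *
      NormedSpace.exp ((-(a * (q / 2))) • (p • (delta 1 - 1))) : ConvAlg ℕ)‖ ^ 2 ≤
      6 * Real.pi * 14 := by
  -- The zeroth power is separate because differentiation lowers the exponent by one.
  rcases a with - | b
  · simp
    have := Real.pi_gt_three
    linarith
  set W := circleIncr p with hW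
  set α : ℝ := ((b + 1 : ℕ) : ℝ) with hα
  have hα' : α = b + 1 := by rw [hα]; push_cast; ring
  have hd : ∀ t, HasDerivAt (fun t => (1 + W t) ^ (b + 1) * cexp ((-(α * (q / 2)) : ℝ) * W t))
      (((b + 1 : ℕ) : ℂ) * (1 + W t) ^ b * (I * (p + W t)) * cexp ((-(α * (q / 2)) : ℝ) * W t) +
        (1 + W t) ^ (b + 1) * (cexp ((-(α * (q / 2)) : ℝ) * W t) *
          ((-(α * (q / 2)) : ℝ) * (I * (p + W t))))) t := by
    intro t
    have h1 := hasDerivAt_circleIncr p t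
    exact ((h1.const_add 1).pow (b + 1)).mul ((h1.const_mul _).cexp)
  have hWc : Continuous W := continuous_circleIncr p
  have hs0 : ∀ t, 0 ≤ 1 - Real.cos t := fun t => by linarith [Real.cos_le_one t]
  have hs2 : ∀ t, 1 - Real.cos t ≤ 2 := fun t => by linarith [Real.neg_one_le_cos t]
  have hq' : q = 1 - p := by linarith
  have hn1 : ∀ t, ‖1 + W t‖ ^ 2 ≤ Real.exp (-(2 * p * q * (1 - Real.cos t))) := by
    intro t
    rw [hW, norm_sq_one_add_circleIncr, ← hq']
    have := Real.add_one_le_exp (-(2 * p * q * (1 - Real.cos t)))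
    linarith
  have hn2 : ∀ t, ‖cexp ((-(α * (q / 2)) : ℝ) * W t)‖ ^ 2 =
      Real.exp (α * p * q * (1 - Real.cos t)) := by
    intro t
    rw [norm_exp, re_ofReal_mul, hW, circleIncr_re, ← Real.exp_nat_mul]
    congr 1; push_cast; ring
  have hN : 0 ≤ α * p * q := by positivity
  refine norm_sq_le_of_circle _ (N := α * p * q) (Q := 14) (c := α * p * (1 - q / 2))
    (fun t => ?_) hd (by fun_prop) hN (by norm_num) (fun t => ?_) (fun t => ?_)
  · have h := evalCircle_smul_delta_sub_one p t
    generalize (p • (delta 1 - 1) : ConvAlg ℕ) = P at h ⊢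
    rw [map_mul, map_pow, map_add, map_one, h, evalCircle_exp, map_smul, h, real_smul]
  · rw [norm_mul, norm_pow, mul_pow, hn2, ← pow_mul, mul_comm (b + 1), pow_mul]
    calc _ ≤ Real.exp (-(2 * p * q * (1 - Real.cos t))) ^ (b + 1) *
          Real.exp (α * p * q * (1 - Real.cos t)) := by gcongr; exact hn1 t
      _ = Real.exp (-(α * p * q * (1 - Real.cos t))) := by
          rw [← Real.exp_nat_mul, ← Real.exp_add, ← hα]; congr 1; ring
      _ ≤ _ := by
          rw [Real.exp_le_exp]
          nlinarith [mul_nonneg hN (hs0 t)]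
  -- The centre c = αp(1 - q/2) is -i times the logarithmic derivative at t = 0, so the centred
  -- derivative acquires a factor W vanishing there.
  · have e : ((b + 1 : ℕ) : ℂ) * (1 + W t) ^ b * (I * (p + W t)) *
          cexp ((-(α * (q / 2)) : ℝ) * W t) +
        (1 + W t) ^ (b + 1) * (cexp ((-(α * (q / 2)) : ℝ) * W t) *
          ((-(α * (q / 2)) : ℝ) * (I * (p + W t)))) -
        I * ((α * p * (1 - q / 2) : ℝ) : ℂ) * ((1 + W t) ^ (b + 1) *
          cexp ((-(α * (q / 2)) : ℝ) * W t)) =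
        (1 + W t) ^ b * cexp ((-(α * (q / 2)) : ℝ) * W t) * ((α * q : ℝ) * W t) *
          (I * ((1 - W t) / 2)) := by
      have hqc : (q : ℂ) = 1 - p := by rw [hq']; push_cast; ring
      rw [hα, pow_succ]
      push_cast
      rw [hqc]
      ring
    rw [e]
    have h3 : ‖I * ((1 - W t) / 2)‖ ≤ 3 / 2 := by
      have h1 : ‖1 + W t‖ ≤ 1 := by
        have := hn1 t
        have h2 : Real.exp (-(2 * p * q * (1 - Real.cos t))) ≤ 1 := by
          rw [Real.exp_le_one_iff]
          have := mul_nonneg (mul_nonneg (mul_nonneg two_pos.le hp.le) hq.le) (hs0 t)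
          linarith
        have := norm_nonneg (1 + W t)
        nlinarith
      rw [norm_mul, norm_I, one_mul, norm_div, show 1 - W t = 2 - (1 + W t) by ring]
      have := norm_sub_le (2 : ℂ) (1 + W t)
      norm_num at this ⊢
      linarith
    have h4 : ‖((α * q : ℝ) : ℂ) * W t‖ ^ 2 = 2 * (α * p * q) ^ 2 * (1 - Real.cos t) := by
      rw [norm_mul, mul_pow, hW, norm_sq_circleIncr, norm_real, Real.norm_eq_abs, sq_abs]
      ring
    set s := 1 - Real.cos t with hs
    set N := α * p * q with hNdef
    rw [norm_mul, norm_mul, norm_mul, norm_pow, mul_pow, mul_pow, mul_pow, hn2, h4, ← pow_mul,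
      mul_comm b, pow_mul]
    -- Pays for the factor |1 + W|² lost by differentiation, using pq ≤ 1/4 and s ≤ 2. The total
    -- constant is 9/2 · 3 ≤ 14.
    have h5 : Real.exp (2 * p * q * s) ≤ 3 := by
      have hpq4 : p * q ≤ 1 / 4 := by nlinarith [sq_nonneg (p - q)]
      have : 2 * p * q * s ≤ 1 := by nlinarith [hs0 t, hs2 t, mul_pos hp hq]
      exact (Real.exp_le_exp.2 this).trans (by linarith [Real.exp_one_lt_d9])
    have h6 := mul_exp_neg_le_exp_neg_half (N * s)
    have hss : 0 ≤ s := hs0 t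
    calc _ ≤ Real.exp (-(2 * p * q * s)) ^ b * Real.exp (N * s) * (2 * N ^ 2 * s) *
          (3 / 2) ^ 2 := by gcongr; exact hn1 t
      _ = 9 / 2 * N * (N * s * Real.exp (-(N * s))) * Real.exp (2 * p * q * s) := by
          have e2 : Real.exp (-(2 * p * q * s)) ^ b * Real.exp (N * s) =
              Real.exp (-(N * s)) * Real.exp (2 * p * q * s) := by
            rw [← Real.exp_nat_mul, ← Real.exp_add, ← Real.exp_add]
            congr 1
            rw [hNdef, hα']; ring
          rw [e2]; ring
      _ ≤ 9 / 2 * N * Real.exp (-(N * s / 2)) * 3 := by gcongr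
      _ ≤ 14 * N * Real.exp (-(N * s / 2)) := by
          have : 0 ≤ N * Real.exp (-(N * s / 2)) := by positivity
          nlinarith
      _ = _ := by congr 2; ring

/-- The analogous bound for the second-order signed compound Poisson factor. -/
theorem norm_sq_hipp_factor_le (b : ℕ) :
    ‖(NormedSpace.exp ((b : ℝ) • (p • (delta 1 - 1) - (1 / 2 : ℝ) • (p • (delta 1 - 1)) ^ 2 -
      (q / 2) • (p • (delta 1 - 1)))) : ConvAlg ℕ)‖ ^ 2 ≤ 6 * Real.pi * (4 / q) := by
  set W := circleIncr p with hW
  have hd : ∀ t, HasDerivAt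
      (fun t => cexp ((b : ℝ) * (W t - (1 / 2 : ℝ) * W t ^ 2 - (q / 2 : ℝ) * W t)))
      (cexp ((b : ℝ) * (W t - (1 / 2 : ℝ) * W t ^ 2 - (q / 2 : ℝ) * W t)) *
        ((b : ℝ) * (I * (p + W t) - (1 / 2 : ℝ) * ((2 : ℕ) * W t ^ 1 * (I * (p + W t))) -
          (q / 2 : ℝ) * (I * (p + W t))))) t := by
    intro t
    have h1 : HasDerivAt W (I * (p + W t)) t := hasDerivAt_circleIncr p t
    exact (((h1.sub ((h1.pow 2).const_mul _)).sub (h1.const_mul _)).const_mul _).cexp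
  have hWc : Continuous W := continuous_circleIncr p
  have hs0 : ∀ t, 0 ≤ 1 - Real.cos t := fun t => by linarith [Real.cos_le_one t]
  have hq' : q = 1 - p := by linarith
  have hN : 0 ≤ b * p * q := by positivity
  have hn : ∀ t, ‖cexp ((b : ℝ) * (W t - (1 / 2 : ℝ) * W t ^ 2 - (q / 2 : ℝ) * W t))‖ ^ 2 =
      Real.exp (-(b * p * q * (1 - Real.cos t))) *
        Real.exp (-(2 * b * p ^ 2 * (1 - Real.cos t) ^ 2)) := by
    intro t
    rw [norm_exp, re_ofReal_mul, sub_re, sub_re, re_ofReal_mul, re_ofReal_mul, hW, circleIncr_re,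
      circleIncr_sq_re, ← Real.exp_nat_mul, ← Real.exp_add]
    congr 1
    push_cast
    rw [hq']
    ring
  have hle : ∀ t, Real.exp (-(2 * b * p ^ 2 * (1 - Real.cos t) ^ 2)) ≤ 1 := fun t => by
    rw [Real.exp_le_one_iff, neg_nonpos]; positivity
  refine norm_sq_le_of_circle _ (N := b * p * q) (Q := 4 / q) (c := b * p * (1 - q / 2))
    (fun t => ?_) hd (by fun_prop) hN ?_ (fun t => ?_) (fun t => ?_)
  · have h := evalCircle_smul_delta_sub_one p t
    generalize (p • (delta 1 - 1) : ConvAlg ℕ) = P at h ⊢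
    rw [evalCircle_exp, map_smul, map_sub, map_sub, map_smul, map_smul, map_pow, h]
    simp only [real_smul, hW, ofReal_natCast]
  · rw [le_div_iff₀ hq]; linarith
  · rw [hn]
    refine (mul_le_of_le_one_right (Real.exp_pos _).le (hle t)).trans ?_
    rw [Real.exp_le_exp]
    nlinarith [mul_nonneg hN (hs0 t)]
  · have e : cexp ((b : ℝ) * (W t - (1 / 2 : ℝ) * W t ^ 2 - (q / 2 : ℝ) * W t)) *
          ((b : ℝ) * (I * (p + W t) - (1 / 2 : ℝ) * ((2 : ℕ) * W t ^ 1 * (I * (p + W t))) -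
            (q / 2 : ℝ) * (I * (p + W t)))) -
        I * ((b * p * (1 - q / 2) : ℝ) : ℂ) *
          cexp ((b : ℝ) * (W t - (1 / 2 : ℝ) * W t ^ 2 - (q / 2 : ℝ) * W t)) =
        cexp ((b : ℝ) * (W t - (1 / 2 : ℝ) * W t ^ 2 - (q / 2 : ℝ) * W t)) *
          (I * ((b : ℝ) * W t * ((q / 2 : ℝ) - W t))) := by
      have hqc : (q : ℂ) = 1 - p := by rw [hq']; push_cast; ring
      push_cast
      rw [hqc]
      ring
    rw [e]
    set s := 1 - Real.cos t with hs
    have hss : 0 ≤ s := hs0 t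
    have h1 : ‖W t‖ ^ 2 = 2 * p ^ 2 * s := norm_sq_circleIncr p t
    have h2 : ‖((q / 2 : ℝ) : ℂ) - W t‖ ^ 2 ≤ q ^ 2 / 2 + 4 * p ^ 2 * s := by
      have h := norm_sub_le (((q / 2 : ℝ) : ℂ)) (W t)
      rw [norm_real, Real.norm_of_nonneg (by positivity)] at h
      have h' := pow_le_pow_left₀ (norm_nonneg _) h 2
      nlinarith [sq_nonneg (q / 2 - ‖W t‖)]
    rw [norm_mul, norm_mul, norm_I, one_mul, norm_mul, norm_mul, norm_real, Real.norm_of_nonneg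
      (Nat.cast_nonneg b), mul_pow, mul_pow, mul_pow, hn, h1]
    set N := b * p * q with hNdef
    have h6 := mul_exp_neg_le_exp_neg_half (N * s)
    -- The extra decay exp(-2bp²s²) absorbs the term quadratic in s. What is left is of size bp² =
    -- Np/q, which causes the loss of 1/q.
    have h7 := mul_exp_neg_half_le_one (2 * (2 * b * p ^ 2 * s ^ 2))
    rw [mul_div_cancel_left₀ _ (two_ne_zero)] at h7
    have h8 : Real.exp (-(N * s)) ≤ Real.exp (-(N * s / 2)) := by
      rw [Real.exp_le_exp]; nlinarith [mul_nonneg hN hss]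
    calc _ ≤ Real.exp (-(N * s)) * Real.exp (-(2 * b * p ^ 2 * s ^ 2)) *
          (b ^ 2 * (2 * p ^ 2 * s) * (q ^ 2 / 2 + 4 * p ^ 2 * s)) := by gcongr
      _ = N * (N * s * Real.exp (-(N * s))) * Real.exp (-(2 * b * p ^ 2 * s ^ 2)) +
          2 * (b * p ^ 2) * (2 * (2 * b * p ^ 2 * s ^ 2) * Real.exp (-(2 * b * p ^ 2 * s ^ 2))) *
            Real.exp (-(N * s)) := by rw [hNdef]; ring
      _ ≤ N * Real.exp (-(N * s / 2)) * 1 +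
          2 * (b * p ^ 2) * 1 * Real.exp (-(N * s / 2)) := by gcongr; exact hle t
      _ = (q + 2 * p) / q * N * Real.exp (-(N * s / 2)) := by rw [hNdef]; field_simp
      _ ≤ 4 / q * N * Real.exp (-(N * s / 2)) := by gcongr; linarith
      _ = _ := by congr 2; ring

omit hp hq hpq in
/-- The contraction property of the substitution of an element of the unit ball into an absolutely
summable power series. -/
theorem exists_substitution {A : Type*} [NormedCommRing A] [NormedAlgebra ℝ A] [CompleteSpace A]
    [NormOneClass A] {V : A} (hV : ‖V‖ ≤ 1) :
    ∃ Φ : ConvAlg ℕ →ₐ[ℝ] A, Φ (delta 1) = V ∧ (∀ f, ‖Φ f‖ ≤ ‖f‖) ∧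
      ∀ f, Φ (NormedSpace.exp f) = NormedSpace.exp (Φ f) := by
  have hVj : ∀ j : ℕ, ‖V ^ j‖ ≤ 1 := fun j =>
    (norm_pow_le V j).trans (pow_le_one₀ (norm_nonneg V) hV)
  refine ⟨lift (fun j : ℕ => V ^ j) hVj (pow_zero V) (pow_add V), ?_, norm_lift_le _ _ _ _,
    lift_exp _ _ _ _⟩
  rw [lift_delta, pow_one]

variable {A : Type*} [NormedCommRing A] [NormedAlgebra ℝ A] [CompleteSpace A] [NormOneClass A]

/-- Substituting V for the variable is a contraction from `ℓ¹(ℕ)`, and 84π ≤ 20². -/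
theorem norm_binomial_factor_le {V : A} (hV : ‖V‖ ≤ 1) (a : ℕ) :
    ‖(1 + p • (V - 1)) ^ a * NormedSpace.exp ((-(a * (q / 2))) • (p • (V - 1)))‖ ≤ 20 := by
  obtain ⟨Φ, hΦ1, hΦn, hΦe⟩ := exists_substitution hV
  have h1 := hΦn ((1 + p • (delta 1 - 1)) ^ a *
    NormedSpace.exp ((-(a * (q / 2))) • (p • (delta 1 - 1))))
  have h2 : Φ (p • (delta 1 - 1)) = p • (V - 1) := by rw [map_smul, map_sub, map_one, hΦ1]
  generalize hP : (p • (delta 1 - 1) : ConvAlg ℕ) = P at h1 h2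
  rw [map_mul, map_pow, map_add, map_one, hΦe, map_smul, h2] at h1
  rw [← hP] at h1
  refine h1.trans (abs_le_of_sq_le_sq' ?_ (by norm_num)).2
  refine (norm_sq_binomial_factor_le hp hq hpq a).trans ?_
  nlinarith [Real.pi_le_four]

theorem norm_hipp_factor_le {V : A} (hV : ‖V‖ ≤ 1) (b : ℕ) :
    ‖NormedSpace.exp ((b : ℝ) • (p • (V - 1) - (1 / 2 : ℝ) • (p • (V - 1)) ^ 2 -
      (q / 2) • (p • (V - 1))))‖ ≤ 10 / √q := by
  obtain ⟨Φ, hΦ1, hΦn, hΦe⟩ := exists_substitution hV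
  have h1 := hΦn (NormedSpace.exp ((b : ℝ) • (p • (delta 1 - 1) -
    (1 / 2 : ℝ) • (p • (delta 1 - 1)) ^ 2 - (q / 2) • (p • (delta 1 - 1)))))
  have h2 : Φ (p • (delta 1 - 1)) = p • (V - 1) := by rw [map_smul, map_sub, map_one, hΦ1]
  generalize hP : (p • (delta 1 - 1) : ConvAlg ℕ) = P at h1 h2
  rw [hΦe, map_smul, map_sub, map_sub, map_smul, map_smul, map_pow, h2] at h1
  rw [← hP] at h1
  refine h1.trans (abs_le_of_sq_le_sq' ?_ (by positivity)).2
  refine (norm_sq_hipp_factor_le hp hq hpq b).trans ?_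
  rw [div_pow, Real.sq_sqrt hq.le, mul_div_assoc', div_le_div_iff_of_pos_right hq]
  nlinarith [Real.pi_lt_d2]

end ConvAlg

/-! ### The norm estimate of the Bergström remainder. -/

namespace ConvAlg

open NormedSpace BanachExp

/-- The constant of the Bergström-type expansion of order `k`. -/
def bergstromConst (k : ℕ) : ℝ :=
  200 * (1 + 8 * Real.exp 4) ^ (k + 1) * Real.exp (k + 1) * (6 * (k + 1)) ^ (3 * (k + 1))

theorem bergstromConst_pos (k : ℕ) : 0 < bergstromConst k := by
  unfold bergstromConst; positivity

/-- `D^{*a} = exp (a (F - 1) - (a / 2) (F - 1)²)` in a Banach algebra. -/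
def hippElem {A : Type*} [NormedCommRing A] [NormedAlgebra ℝ A] (F : A) (a : ℝ) : A :=
  exp (a • (F - 1) - (a / 2) • (F - 1) ^ 2)

theorem hippElem_natCast {A : Type*} [NormedCommRing A] [NormedAlgebra ℝ A] [CompleteSpace A]
    (F : A) (m : ℕ) : hippElem F m = hippElem F 1 ^ m := by
  rw [hippElem, hippElem, ← exp_natCast_smul]
  congr 1
  module

section remainder

variable {A : Type*} [NormedCommRing A] [NormedAlgebra ℝ A] [CompleteSpace A] [NormOneClass A]

/-- The two exponents in every summand add up to n - 1 - k, so all summands share one exponential.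
The cofactors are bounded by 20 · 10/√q, the binomials by n^k, and there are at most n summands. -/
theorem norm_bergstrom_kernel_le {p q : ℝ} (hp : 0 < p) (hq : 0 < q) (hpq : p + q = 1) {F V : A}
    (hV : ‖V‖ ≤ 1) (hF : F - 1 = p • (V - 1)) {k n : ℕ} (hkn : k < n) :
    ∃ K : A, ‖K‖ ≤ 200 * n ^ (k + 1) / √q ∧
      ∑ s ∈ Finset.Ico k n, (s.choose k : A) * (F ^ (n - 1 - s) * hippElem F 1 ^ (s - k)) =
        exp ((((n - 1 - k : ℕ) : ℝ) * (q / 2)) • (F - 1)) * K := by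
  set w := F - 1 with hw
  set u : ℕ → A := fun a => (1 + w) ^ a * exp ((-(a * (q / 2))) • w) with hu
  set v : ℕ → A := fun b => exp ((b : ℝ) • (w - (1 / 2 : ℝ) • w ^ 2 - (q / 2) • w)) with hv
  have hu' : ∀ a, ‖u a‖ ≤ 20 := fun a => by
    simp only [hu, hF]; exact norm_binomial_factor_le hp hq hpq hV a
  have hv' : ∀ b, ‖v b‖ ≤ 10 / √q := fun b => by
    simp only [hv, hF]; exact norm_hipp_factor_le hp hq hpq hV b
  refine ⟨∑ s ∈ Finset.Ico k n, (s.choose k : ℝ) • (u (n - 1 - s) * v (s - k)), ?_, ?_⟩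
  · calc _ ≤ ∑ s ∈ Finset.Ico k n, (n : ℝ) ^ k * (20 * (10 / √q)) := by
          refine norm_sum_le_of_le _ fun s hs => ?_
          rw [norm_smul, RCLike.norm_natCast]
          have hsn : s ≤ n := (Finset.mem_Ico.1 hs).2.le
          have h1 : (s.choose k : ℝ) ≤ (n : ℝ) ^ k := by
            exact_mod_cast (Nat.choose_le_pow s k).trans (Nat.pow_le_pow_left hsn k)
          have h2 : ‖u (n - 1 - s) * v (s - k)‖ ≤ 20 * (10 / √q) :=
            (norm_mul_le _ _).trans
              (mul_le_mul (hu' _) (hv' _) (norm_nonneg _) (by norm_num))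
          gcongr
      _ = ((n - k : ℕ) : ℝ) * ((n : ℝ) ^ k * (20 * (10 / √q))) := by
          rw [Finset.sum_const, Nat.card_Ico, nsmul_eq_mul]
      _ ≤ (n : ℝ) * ((n : ℝ) ^ k * (20 * (10 / √q))) := by
          gcongr
          omega
      _ = _ := by rw [pow_succ]; ring
  · rw [Finset.mul_sum]
    refine Finset.sum_congr rfl fun s hs => ?_
    have hs' := Finset.mem_Ico.1 hs
    have hF1 : F = 1 + w := by rw [hw]; ring
    rw [← hippElem_natCast, hippElem, ← hw]
    simp only [hu, hv]
    rw [← nsmul_eq_mul, ← Nat.cast_smul_eq_nsmul ℝ, mul_smul_comm]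
    refine congrArg _ ?_
    have e : exp (((s - k : ℕ) : ℝ) • w - (((s - k : ℕ) : ℝ) / 2) • w ^ 2) =
        exp ((((n - 1 - k : ℕ) : ℝ) * (q / 2)) • w) * exp ((-((n - 1 - s : ℕ) * (q / 2))) • w) *
          exp (((s - k : ℕ) : ℝ) • (w - (1 / 2 : ℝ) • w ^ 2 - (q / 2) • w)) := by
      rw [← exp_add_real, ← exp_add_real]
      congr 1
      rw [show n - 1 - k = (n - 1 - s) + (s - k) by omega, Nat.cast_add]
      module
    rw [e, ← hF1]
    ring

end remainder

variable {G : Type*} [AddCommGroup G]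

theorem norm_bergstrom_le {F : ConvAlg G} (h0 : ∀ x, 0 ≤ F x) (h1 : ‖F‖ = 1)
    (hs : ∀ x, F (-x) = F x) {q : ℝ} (hFq : F 0 = q) (hq : 0 < q) (hq1 : q < 1) {k n : ℕ}
    (hkn : k < n) :
    ‖F ^ n - ∑ m ∈ Finset.range (k + 1), (n.choose m : ℝ) •
        (hippElem F (n - m) * (F - hippElem F 1) ^ m)‖ ≤
      bergstromConst k * (∑' x : {x : G // x ≠ 0}, min 1 (n * q * Real.exp 1 * F x)) ^ (3 * (k + 1))
        / (q ^ (6 * (k : ℝ) + 11 / 2) * (n : ℝ) ^ (2 * (k + 1))) := by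
  classical
  set d := ∑' x : {x : G // x ≠ 0}, min 1 (n * q * Real.exp 1 * F x) with hd
  set p := 1 - q with hp
  have hp0 : 0 < p := by linarith
  have hn : (0 : ℝ) < n := by exact_mod_cast (Nat.zero_le k).trans_lt hkn
  have hd0 : 0 ≤ d := tsum_nonneg fun x => le_min zero_le_one (by have := h0 x; positivity)
  -- F conditioned on being nonzero.
  set V : ConvAlg G := p⁻¹ • (F - q • 1) with hV
  have hVn : ‖V‖ ≤ 1 := by
    have hnn : ∀ x, 0 ≤ (F - q • (1 : ConvAlg G)) x := by
      intro x
      rw [lp.coeFn_sub, lp.coeFn_smul, Pi.sub_apply, Pi.smul_apply, one_def, delta_apply,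
        smul_eq_mul]
      split_ifs with hx
      · rw [hx, hFq]; simp
      · simpa using h0 x
    rw [hV, norm_smul, norm_inv, Real.norm_of_nonneg hp0.le, norm_eq_of_nonneg hnn, map_sub,
      map_smul, one_def, extend_delta, ← norm_eq_of_nonneg h0, h1]
    simp only [smul_eq_mul, mul_one]
    rw [← hp, inv_mul_cancel₀ hp0.ne']
  have hw : F - 1 = p • (V - 1) := by
    rw [hV, smul_sub, smul_smul, mul_inv_cancel₀ hp0.ne', hp]; module
  set w := F - 1 with hwdef
  have hwn : ‖w‖ ≤ 2 := by
    refine (norm_sub_le _ _).trans ?_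
    rw [h1, norm_one]; norm_num
  obtain ⟨K, hK, hKe⟩ := norm_bergstrom_kernel_le hp0 hq (by rw [hp]; ring) hVn hw hkn
  set J := 3 * (k + 1) with hJ
  have hJ0 : (0 : ℝ) < J := by rw [hJ]; positivity
  -- One J-th of nq/2, so that each of the J factors w receives an equal share of the exponential.
  set a := n * q / (2 * J) with ha
  have ha0 : 0 < a := by positivity
  have hsm : ‖w * exp (a • w)‖ ≤ 1 / a * d := by
    refine norm_sub_one_mul_exp_le h0 h1 hs ha0 ?_
    have hJ1 : (1 : ℝ) ≤ J := by rw [hJ]; push_cast; linarith [(Nat.cast_nonneg k : (0 : ℝ) ≤ k)]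
    calc 2 * a = n * q * (1 / J) := by rw [ha]; field_simp
      _ ≤ n * q * Real.exp 1 := by
          gcongr
          exact ((div_le_one hJ0).2 hJ1).trans (by linarith [Real.add_one_le_exp (1 : ℝ)])
  have hid : F ^ n - ∑ m ∈ Finset.range (k + 1), (n.choose m : ℝ) •
      (hippElem F (n - m) * (F - hippElem F 1) ^ m) =
      (w * exp (a • w)) ^ J * (hippFactor w ^ (k + 1) *
        (exp ((-((k + 1) * (q / 2))) • w) * K)) := by
    have e1 : ∀ m ∈ Finset.range (k + 1), (n.choose m : ℝ) •
        (hippElem F (n - m) * (F - hippElem F 1) ^ m) =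
        (n.choose m : ConvAlg G) * (hippElem F 1 ^ (n - m) * (F - hippElem F 1) ^ m) := by
      intro m hm
      have hmn : m ≤ n := by have := Finset.mem_range.1 hm; omega
      rw [← Nat.cast_sub hmn, hippElem_natCast, Nat.cast_smul_eq_nsmul, nsmul_eq_mul]
    have e2 : F - hippElem F 1 = w ^ 3 * hippFactor w := by
      rw [← one_add_sub_exp, hippElem, ← hwdef, one_smul, hwdef]
      ring
    have e3 : (w * exp (a • w)) ^ J = w ^ J * exp ((n * (q / 2)) • w) := by
      rw [mul_pow, ← exp_natCast_smul, smul_smul]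
      congr 3
      rw [ha]; field_simp
    -- Replaces n - 1 - k by n in the exponent; the correcting factor costs at most exp(k + 1), as
    -- ‖w‖ ≤ 2 and q ≤ 1.
    have e4 : exp ((n * (q / 2)) • w) * exp ((-((k + 1) * (q / 2))) • w) =
        exp ((((n - 1 - k : ℕ) : ℝ) * (q / 2)) • w) := by
      rw [← exp_add_real]
      congr 1
      rw [show n - 1 - k = n - (k + 1) by omega, Nat.cast_sub hkn]
      push_cast
      module
    rw [Finset.sum_congr rfl e1, bergstrom_identity F _ k n hkn.le, hKe, e2, e3, ← e4, mul_pow,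
      ← pow_mul, ← hJ]
    ring
  have hexp : ‖exp ((-((k + 1) * (q / 2))) • w)‖ ≤ Real.exp (k + 1) := by
    refine (norm_exp_le _).trans (Real.exp_le_exp.2 ?_)
    rw [norm_smul, norm_neg, Real.norm_of_nonneg (by positivity)]
    calc ((k : ℝ) + 1) * (q / 2) * ‖w‖ ≤ ((k : ℝ) + 1) * (1 / 2) * 2 := by gcongr
      _ = _ := by ring
  rw [hid]
  calc _ ≤ (1 / a * d) ^ J * ((1 + 8 * Real.exp 4) ^ (k + 1) *
        (Real.exp (k + 1) * (200 * n ^ (k + 1) / √q))) := by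
        refine (norm_mul_le _ _).trans ?_
        refine mul_le_mul ((norm_pow_le _ _).trans (by gcongr)) ?_ (norm_nonneg _) (by positivity)
        refine (norm_mul_le _ _).trans ?_
        refine mul_le_mul ((norm_pow_le _ _).trans (pow_le_pow_left₀ (norm_nonneg _)
          (norm_hippFactor_le hwn) _)) ?_ (norm_nonneg _) (by positivity)
        refine (norm_mul_le _ _).trans ?_
        exact mul_le_mul hexp hK (norm_nonneg _) (by positivity)
    _ = bergstromConst k * d ^ J / ((q ^ J * √q) * (n : ℝ) ^ (2 * (k + 1))) := by
        have e1 : 1 / a = 6 * (k + 1) / (n * q) := by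
          rw [ha, hJ]; push_cast; field_simp; ring
        have e2 : (n : ℝ) ^ J = (n : ℝ) ^ (2 * (k + 1)) * (n : ℝ) ^ (k + 1) := by
          rw [← pow_add, hJ]; congr 1; ring
        have hsq : √q ≠ 0 := (Real.sqrt_pos.2 hq).ne'
        rw [e1, bergstromConst, ← hJ, mul_pow, div_pow, mul_pow (n : ℝ) q, e2]
        field_simp
    _ ≤ _ := by
        -- The argument yields the exponent 3k + 7/2; since q < 1, a larger exponent only weakens
        -- the bound.
        have hle : q ^ (6 * (k : ℝ) + 11 / 2) ≤ q ^ J * √q := by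
          rw [Real.sqrt_eq_rpow, ← Real.rpow_natCast, ← Real.rpow_add hq]
          refine Real.rpow_le_rpow_of_exponent_ge hq hq1.le ?_
          rw [hJ]
          push_cast
          linarith [(Nat.cast_nonneg k : (0 : ℝ) ≤ k)]
        have := bergstromConst_pos k
        gcongr

end ConvAlg

/-! ### Transfer from weights to atomic signed measures. -/

namespace ConvAlg

open SignedConv

section atomic

variable {κ X : Type*} [MeasurableSpace X]

theorem norm_dirac_one_le (x : X) (B : Set X) :
    ‖(VectorMeasure.dirac x 1 : SignedMeasure X) B‖ ≤ 1 := by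
  by_cases hB : MeasurableSet B
  · by_cases hx : x ∈ B
    · rw [VectorMeasure.dirac_apply_of_mem hB hx]; simp
    · rw [VectorMeasure.dirac_apply_of_notMem hx]; simp
  · rw [VectorMeasure.not_measurable _ hB]; simp

theorem dirac_one_nonneg (x : X) (B : Set X) :
    0 ≤ (VectorMeasure.dirac x 1 : SignedMeasure X) B := by
  by_cases hB : MeasurableSet B
  · by_cases hx : x ∈ B
    · rw [VectorMeasure.dirac_apply_of_mem hB hx]; simp
    · rw [VectorMeasure.dirac_apply_of_notMem hx]
  · rw [VectorMeasure.not_measurable _ hB]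

/-- Countable additivity is the interchange of an absolutely summable double series. -/
theorem hasSum_tsum_mul_dirac {c : κ → ℝ} (hc : Summable fun z => |c z|) (u : κ → X)
    {f : ℕ → Set X} (hf : ∀ i, MeasurableSet (f i)) (hd : Pairwise (Function.onFun Disjoint f)) :
    HasSum (fun i => ∑' z, c z * (VectorMeasure.dirac (u z) 1 : SignedMeasure X) (f i))
      (∑' z, c z * (VectorMeasure.dirac (u z) 1 : SignedMeasure X) (⋃ i, f i)) := by
  set m : κ → Set X → ℝ := fun z B => (VectorMeasure.dirac (u z) 1 : SignedMeasure X) B with hm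
  have hm0 : ∀ z B, 0 ≤ m z B := fun z B => dirac_one_nonneg _ _
  have hm1 : ∀ z B, m z B ≤ 1 := fun z B => (Real.le_norm_self _).trans (norm_dirac_one_le _ _)
  have hrow : ∀ z, HasSum (fun i => m z (f i)) (m z (⋃ i, f i)) := fun z =>
    VectorMeasure.m_iUnion _ hf hd
  have hb : Summable fun r : κ × ℕ => |c r.1| * m r.1 (f r.2) := by
    have h0 : ∀ r : κ × ℕ, 0 ≤ |c r.1| * m r.1 (f r.2) := fun r =>
      mul_nonneg (abs_nonneg (c r.1)) (hm0 _ _)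
    refine (summable_prod_of_nonneg h0).2 ⟨fun z => (hrow z).summable.mul_left |c z|, ?_⟩
    refine Summable.of_nonneg_of_le (fun z => tsum_nonneg fun i => h0 (z, i)) (fun z => ?_) hc
    have ht : ∑' i, |c z| * m z (f i) = |c z| * m z (⋃ i, f i) := ((hrow z).mul_left |c z|).tsum_eq
    exact ht.le.trans (mul_le_of_le_one_right (abs_nonneg (c z)) (hm1 _ _))
  have hsum : Summable fun r : κ × ℕ => c r.1 * m r.1 (f r.2) := by
    refine Summable.of_norm_bounded hb fun r => ?_
    rw [norm_mul, Real.norm_eq_abs, Real.norm_of_nonneg (hm0 _ _)]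
  have h1 : HasSum (fun z => c z * m z (⋃ i, f i)) (∑' r : κ × ℕ, c r.1 * m r.1 (f r.2)) :=
    HasSum.prod_fiberwise hsum.hasSum fun z => (hrow z).mul_left (c z)
  have h2 : HasSum (fun r : ℕ × κ => c r.2 * m r.2 (f r.1))
      (∑' r : κ × ℕ, c r.1 * m r.1 (f r.2)) :=
    (Equiv.prodComm ℕ κ).hasSum_iff.mpr hsum.hasSum
  rw [h1.tsum_eq]
  exact HasSum.prod_fiberwise h2 fun i => (h2.summable.prod_factor i).hasSum

/-- The mass of `B` under the atomic measure, as a continuous linear functional of the weights. -/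
def atomicMass (u : κ → X) (B : Set X) : ConvAlg κ →L[ℝ] ℝ :=
  extend (fun z => (VectorMeasure.dirac (u z) 1 : SignedMeasure X) B)
    fun _ => norm_dirac_one_le _ _

theorem atomicMass_delta (u : κ → X) (B : Set X) (z : κ) :
    atomicMass u B (delta z) = (VectorMeasure.dirac (u z) 1 : SignedMeasure X) B :=
  extend_delta _ _ _

theorem hasSum_atomicMass (u : κ → X) (B : Set X) (c : ConvAlg κ) :
    HasSum (fun z => c z * (VectorMeasure.dirac (u z) 1 : SignedMeasure X) B)
      (atomicMass u B c) :=
  hasSum_extend _ _ c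

/-- The atomic signed measure `∑ c_z δ_{u z}`. -/
def atomic (u : κ → X) (c : ConvAlg κ) : SignedMeasure X where
  measureOf' B := atomicMass u B c
  empty' := by simp [atomicMass, extend_apply]
  not_measurable' B hB := by simp [atomicMass, extend_apply, VectorMeasure.not_measurable _ hB]
  m_iUnion' _ hf hd := hasSum_tsum_mul_dirac (hasSum_norm c).summable u hf hd

theorem atomic_apply (u : κ → X) (c : ConvAlg κ) (B : Set X) :
    atomic u c B = atomicMass u B c := rfl

theorem atomic_add (u : κ → X) (c e : ConvAlg κ) : atomic u (c + e) = atomic u c + atomic u e := by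
  ext B _
  rw [_root_.add_apply, atomic_apply, atomic_apply, atomic_apply, map_add]

theorem atomic_smul (u : κ → X) (r : ℝ) (c : ConvAlg κ) : atomic u (r • c) = r • atomic u c := by
  ext B _
  rw [_root_.smul_apply, atomic_apply, atomic_apply, map_smul]

/-- `atomic` as a linear map. -/
def atomicₗ (u : κ → X) : ConvAlg κ →ₗ[ℝ] SignedMeasure X where
  toFun := atomic u
  map_add' := atomic_add u
  map_smul' := atomic_smul u

theorem atomic_delta (u : κ → X) (z : κ) : atomic u (delta z) = VectorMeasure.dirac (u z) 1 := by
  ext B _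
  rw [atomic_apply, atomicMass_delta]

/-- With P a Hahn set, the total variation is M(P) - M(Pᶜ), and each atom enters exactly one of the
two terms, with sign ±. -/
theorem tvNorm_atomic_le (u : κ → X) (c : ConvAlg κ) : tvNorm (atomic u c) ≤ ‖c‖ := by
  obtain ⟨P, hP, hP1, hP2, hpos, hneg⟩ := (atomic u c).toJordanDecomposition_spec
  rw [tvNorm, SignedMeasure.totalVariation, measureReal_add_apply, hpos, hneg,
    SignedMeasure.toMeasureOfZeroLE_real_apply _ hP1 hP MeasurableSet.univ,
    SignedMeasure.toMeasureOfLEZero_real_apply _ hP2 hP.compl MeasurableSet.univ, inter_univ,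
    inter_univ, atomic_apply, atomic_apply]
  refine hasSum_le (fun z => ?_) ((hasSum_atomicMass u P c).add (hasSum_atomicMass u Pᶜ c).neg)
    (hasSum_norm c)
  by_cases h : u z ∈ P
  · rw [VectorMeasure.dirac_apply_of_mem hP h,
      VectorMeasure.dirac_apply_of_notMem (notMem_compl_iff.2 h)]
    simpa using le_abs_self (c z)
  · rw [VectorMeasure.dirac_apply_of_notMem h, VectorMeasure.dirac_apply_of_mem hP.compl h]
    simpa using neg_le_abs (c z)

end atomic

/-- The tensor product `ℓ¹(κ) × ℓ¹(κ') → ℓ¹(κ × κ')`. -/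
def tensor {κ κ' : Type*} : ConvAlg κ →L[ℝ] ConvAlg κ' →L[ℝ] ConvAlg (κ × κ') :=
  extend (fun x => extend (fun y => delta (x, y)) fun _ => (norm_delta _).le)
    fun _ => norm_extend_le _ _

/-- The density argument for bilinear maps: products and convolutions need only be compared on pairs
of unit masses. -/
theorem apply_tensor {κ κ' E : Type*} [NormedAddCommGroup E] [NormedSpace ℝ E]
    (S : ConvAlg (κ × κ') →L[ℝ] E) (B : ConvAlg κ →L[ℝ] ConvAlg κ' →L[ℝ] E)
    (h : ∀ x y, S (delta (x, y)) = B (delta x) (delta y)) (f : ConvAlg κ) (g : ConvAlg κ') :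
    S (tensor f g) = B f g := by
  have h1 : ∀ x, S ∘L tensor (delta x) = B (delta x) := fun x => clm_ext fun y => by
    simp [tensor, h]
  have h2 : S ∘L tensor.flip g = B.flip g := clm_ext fun x => by
    simpa using DFunLike.congr_fun (h1 x) g
  simpa using DFunLike.congr_fun h2 f

theorem prod_atomic {κ κ' X Y : Type*} [MeasurableSpace X] [MeasurableSpace Y] (u : κ → X)
    (v : κ' → Y) (f : ConvAlg κ) (g : ConvAlg κ') :
    (atomic u f).prod (atomic v g) (ContinuousLinearMap.mul ℝ ℝ) =
      atomic (Prod.map u v) (tensor f g) := by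
  refine VectorMeasure.prod_eq_of_forall_apply_prod fun s t hs ht => ?_
  rw [atomic_apply, atomic_apply, atomic_apply]
  refine apply_tensor _ ((ContinuousLinearMap.mul ℝ ℝ).bilinearComp (atomicMass u s)
    (atomicMass v t)) (fun x y => ?_) f g
  rw [ContinuousLinearMap.bilinearComp_apply, ContinuousLinearMap.mul_apply', atomicMass_delta,
    atomicMass_delta, atomicMass_delta, Prod.map_apply]
  by_cases hx : u x ∈ s
  · by_cases hy : v y ∈ t
    · rw [VectorMeasure.dirac_apply_of_mem hs hx, VectorMeasure.dirac_apply_of_mem ht hy,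
        VectorMeasure.dirac_apply_of_mem (hs.prod ht) (mk_mem_prod hx hy), mul_one]
    · rw [VectorMeasure.dirac_apply_of_notMem hy, mul_zero,
        VectorMeasure.dirac_apply_of_notMem fun h => hy (mem_prod.1 h).2]
  · rw [VectorMeasure.dirac_apply_of_notMem hx, zero_mul,
      VectorMeasure.dirac_apply_of_notMem fun h => hx (mem_prod.1 h).1]

section group

variable {G H : Type*} [AddCommMonoid G] [AddCommGroup H] [MeasurableSpace H] (φ : G →+ H)

theorem atomic_one : atomic φ 1 = unitMass 0 := by
  rw [one_def, atomic_delta, map_zero]; rfl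

variable [MeasurableAdd₂ H]

theorem convolve_atomic (f g : ConvAlg G) :
    convolve (atomic φ f) (atomic φ g) = atomic φ (f * g) := by
  rw [convolve, prod_atomic]
  ext B hB
  rw [VectorMeasure.map_apply _ measurable_add hB, atomic_apply, atomic_apply, mul_def]
  refine apply_tensor _ (ContinuousLinearMap.compL ℝ (ConvAlg G) (ConvAlg G) ℝ
    (atomicMass φ B) ∘L mulL) (fun x y => ?_) f g
  simp only [ContinuousLinearMap.comp_apply, ContinuousLinearMap.compL_apply, mulL_delta,
    atomicMass_delta, map_add, Prod.map_apply]
  have hB' : MeasurableSet ((fun p : H × H => p.1 + p.2) ⁻¹' B) := measurable_add hB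
  by_cases h : φ x + φ y ∈ B
  · rw [VectorMeasure.dirac_apply_of_mem hB h, VectorMeasure.dirac_apply_of_mem hB' h]
  · rw [VectorMeasure.dirac_apply_of_notMem h, VectorMeasure.dirac_apply_of_notMem (by exact h)]

theorem convPow_atomic (f : ConvAlg G) (j : ℕ) :
    convPow (atomic φ f) j = atomic φ (f ^ j) := by
  induction j with
  | zero => rw [pow_zero, atomic_one]; rfl
  | succ j ih => rw [pow_succ, ← convolve_atomic, ← ih]; rfl

/-- The mass of a fixed set is a continuous functional of the weights, so it may be applied termwise
to the norm-convergent exponential series. -/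
theorem convExp_atomic (f : ConvAlg G) :
    convExp (atomic φ f) = atomic φ (NormedSpace.exp f) := by
  ext B _
  have h := (BanachExp.hasSum_exp f).mapL (atomicMass φ B)
  refine Eq.trans ?_ h.tsum_eq
  refine tsum_congr fun j => ?_
  rw [convPow_atomic, atomic_apply, map_smul, smul_eq_mul]

variable {F : Measure H} [IsFiniteMeasure F] {f : ConvAlg G}

omit [MeasurableAdd₂ H] in
theorem centred_atomic (hF : F.toSignedMeasure = atomic φ f) :
    centred F = atomic φ (f - 1) := by
  rw [centred, hF, ← atomic_one φ]
  exact (map_sub (atomicₗ φ) f 1).symm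

theorem hipp_atomic (hF : F.toSignedMeasure = atomic φ f) (a : ℝ) :
    hipp F a = atomic φ (hippElem f a) := by
  rw [hipp, centred_atomic φ hF, convPow_atomic, ← atomic_smul, ← atomic_smul, hippElem,
    ← convExp_atomic]
  congr 1
  exact (map_sub (atomicₗ (φ : G → H)) _ _).symm

theorem bergstromRemainder_atomic (hF : F.toSignedMeasure = atomic φ f) (n k : ℕ) :
    bergstromRemainder F n k = atomic φ (f ^ n - ∑ m ∈ Finset.range (k + 1), (n.choose m : ℝ) •
      (hippElem f (n - m) * (f - hippElem f 1) ^ m)) := by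
  have hsub : F.toSignedMeasure - hipp F 1 = atomic φ (f - hippElem f 1) := by
    rw [hF, hipp_atomic φ hF]
    exact (map_sub (atomicₗ (φ : G → H)) _ _).symm
  have hsum := map_sum (atomicₗ φ) (fun m => (n.choose m : ℝ) •
      (hippElem f (n - m) * (f - hippElem f 1) ^ m)) (Finset.range (k + 1))
  rw [bergstromRemainder, hsub, hF, convPow_atomic]
  refine Eq.trans ?_ (map_sub (atomicₗ (φ : G → H)) _ _).symm
  rw [hsum]
  congr 1
  refine Finset.sum_congr rfl fun m _ => ?_
  rw [hipp_atomic φ hF, convPow_atomic, convolve_atomic, ← atomic_smul]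
  rfl

end group

/-- A finite measure concentrated on the values of an injective countable family is atomic. -/
theorem exists_toSignedMeasure_eq_atomic {κ X : Type*} [Countable κ] [MeasurableSpace X]
    [MeasurableSingletonClass X] {u : κ → X} (hu : Function.Injective u) (F : Measure X)
    [IsFiniteMeasure F] (hF : F (range u)ᶜ = 0) :
    ∃ f : ConvAlg κ, (∀ z, f z = F.real {u z}) ∧ F.toSignedMeasure = atomic u f := by
  have hB : ∀ B, MeasurableSet B → HasSum (fun z => F.real (B ∩ {u z})) (F.real B) := by
    intro B hBm
    have h1 : F B = F (⋃ z, B ∩ {u z}) := by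
      rw [← inter_iUnion, iUnion_singleton_eq_range]
      exact (measure_inter_conull hF).symm
    have h2 : F B = ∑' z, F (B ∩ {u z}) := by
      rw [h1]
      refine measure_iUnion (fun x y hxy => ?_) fun z => hBm.inter (measurableSet_singleton _)
      refine Disjoint.inter_left' _ (Disjoint.inter_right' _ ?_)
      exact disjoint_singleton.2 (hu.ne hxy)
    have h3 : ∑' z, F (B ∩ {u z}) ≠ ⊤ := h2 ▸ measure_ne_top F B
    rw [measureReal_def, h2, ENNReal.tsum_toReal_eq fun z => measure_ne_top F _]
    exact ENNReal.hasSum_toReal h3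
  have hs : Summable fun z => F.real {u z} := by
    simpa using (hB univ MeasurableSet.univ).summable
  refine ⟨⟨fun z => F.real {u z}, memℓp_gen (by simpa [abs_of_nonneg measureReal_nonneg] using hs)⟩, fun z => rfl, ?_⟩
  ext B hBm
  rw [Measure.toSignedMeasure_apply_measurable hBm, atomic_apply]
  refine (hB B hBm).unique ((hasSum_atomicMass u B _).congr_of_eq (fun z => ?_) rfl)
  by_cases h : u z ∈ B
  · rw [VectorMeasure.dirac_apply_of_mem hBm h, mul_one,
      inter_eq_right.2 (singleton_subset_iff.2 h)]
  · rw [VectorMeasure.dirac_apply_of_notMem h, mul_zero,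
      disjoint_iff_inter_eq_empty.1 (disjoint_singleton_right.2 h), measureReal_empty]

end ConvAlg

/-! ### The integer lattice and the theorem. -/

namespace IntegerLattice

/-- The embedding of `ℤ^d` into `ℝ^d`, as an additive homomorphism. -/
def latticeHom (d : ℕ) : (Fin d → ℤ) →+ EuclideanSpace ℝ (Fin d) where
  toFun := latticePoint
  map_zero' := by ext i; simp [latticePoint]
  map_add' x y := by ext i; simp [latticePoint]

theorem latticePoint_injective (d : ℕ) : Function.Injective (latticePoint (d := d)) := by
  intro x y h
  ext i
  have := congrArg (fun v : EuclideanSpace ℝ (Fin d) => v i) h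
  simpa [latticePoint] using this

end IntegerLattice

end

theorem theorem7 (k : ℕ) :
    ∃ C : ℝ, 0 < C ∧
      ∀ (d : ℕ) (F : Measure (EuclideanSpace ℝ (Fin d))) [IsProbabilityMeasure F],
        F.map (fun x => -x) = F →
        F.support ⊆ range (IntegerLattice.latticePoint (d := d)) →
        ∀ q : ℝ, q = F.real {0} → 0 < q → q < 1 →
        ∀ n : ℕ, k < n →
          SignedConv.tvNorm (SignedConv.bergstromRemainder F n k) ≤
            C * IntegerLattice.delta F (n * q) ^ (3 * (k + 1)) /
                (q ^ (6 * (k : ℝ) + 11 / 2) * (n : ℝ) ^ (2 * (k + 1))) +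
              C * (1 - q) ^ (6 * (k + 1)) /
                ((n : ℝ) ^ (2 * (k + 1)) * q ^ (6 * (k : ℝ) + 13 / 2)) := by
  refine ⟨ConvAlg.bergstromConst k, ConvAlg.bergstromConst_pos k, ?_⟩
  intro d F _ hsymm hsupp q hq hq0 hq1 n hkn
  have hnull : F (range (IntegerLattice.latticePoint (d := d)))ᶜ = 0 :=
    measure_mono_null (compl_subset_compl.2 hsupp) Measure.measure_compl_support
  obtain ⟨f, hf, hFf⟩ := ConvAlg.exists_toSignedMeasure_eq_atomic
    (IntegerLattice.latticePoint_injective d) F hnull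
  let φ := IntegerLattice.latticeHom d
  have h0 : ∀ z, 0 ≤ f z := fun z => by rw [hf]; exact measureReal_nonneg
  have h1 : ‖f‖ = 1 := by
    have h : F.toSignedMeasure univ = 1 := by
      rw [Measure.toSignedMeasure_apply_measurable MeasurableSet.univ, probReal_univ]
    rw [hFf, ConvAlg.atomic_apply] at h
    rw [← h]
    refine (ConvAlg.hasSum_norm f).unique
      ((ConvAlg.hasSum_atomicMass _ univ f).congr_of_eq (fun z => ?_) rfl)
    rw [VectorMeasure.dirac_apply_of_mem MeasurableSet.univ (mem_univ _), mul_one,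
      abs_of_nonneg (h0 z)]
  have hs : ∀ z, f (-z) = f z := by
    intro z
    have e : (fun x => -x) ⁻¹' {IntegerLattice.latticePoint z} =
        {IntegerLattice.latticePoint (-z)} := by
      have : IntegerLattice.latticePoint (-z) = -IntegerLattice.latticePoint z := map_neg φ z
      rw [this]
      ext x
      simp
    rw [hf, hf, ← e, measureReal_def, measureReal_def,
      ← Measure.map_apply measurable_neg (measurableSet_singleton _), hsymm]
  have hz : f 0 = q := by
    have : IntegerLattice.latticePoint (0 : Fin d → ℤ) = 0 := map_zero φ
    rw [hf, hq, this]
  have hmain := ConvAlg.norm_bergstrom_le h0 h1 hs hz hq0 hq1 hkn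
  have hδ : IntegerLattice.delta F (n * q) =
      ∑' x : {x : Fin d → ℤ // x ≠ 0}, min 1 (n * q * Real.exp 1 * f x) := by
    simp only [IntegerLattice.delta, hf]
  have hatom : F.toSignedMeasure = ConvAlg.atomic φ f := hFf
  rw [ConvAlg.bergstromRemainder_atomic φ hatom, hδ]
  -- The first summand already dominates; the second is added because it is nonnegative.
  refine (ConvAlg.tvNorm_atomic_le _ _).trans (hmain.trans (le_add_of_nonneg_right ?_))
  have := ConvAlg.bergstromConst_pos k
  have : 0 < 1 - q := by linarith
  positivity
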